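/- **Theorem (conformal Bochner formula).** Let $M$ be a smooth manifold of dimension $n$. For $k\in\mathbb R$ let $L^k=GL(M)\times_{|\det|^{k/n}}\mathbb R$ be the line bundle of densities of weight $k$. Let $c$ be a conformal structure on $M$, that is a smooth, symmetric, positive definite section of $L^{2}\otimes T^*M\otimes T^*M$, normalised so that $\det c$ is the natural isomorphism $\Lambda^nT^*M\otimes\Lambda^nT^*M\cong L^{-2n}$; the metrics in the conformal class are the $l^{-2}c$ with $l$ a positive section of $L$. Let $D$ be a Weyl connection on $(M,c)$: a smooth torsion-free linear connection on $TM$ with $Dc=0$, where $D$ also denotes the induced connections on $L^k$ and on all $L^k$-valued tensors. Let $\{e_i\}$ denote $c$-orthonormal frames, $l$ the associated section of $L$ (so $c(e_i,e_j)=\delta_{ij}l^2$) and $\{e_i^*\}$ the dual frame. For sections $\omega$ of $L^k\otimes\Lambda^pT^*M$ ($p$-forms of weight $k$) put $$d^D\omega=\sum_i e_i^*\wedge D_{e_i}\omega\in L^k\otimes\Lambda^{p+1}T^*M,\qquad \delta^D\omega=-\sum_i (e_i\lrcorner D_{e_i}\omega)\,l^{-2}\in L^{k-2}\otimes\Lambda^{p-1}T^*M,$$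 let $\mathscr D^D=d^D+\delta^D$ (the Weyl–Dirac operator, acting on inhomogeneous forms with weights), $\Delta^D=-\mathrm{tr}_c(D\circ D)$, $\mathrm R^D_{X,Y}Z=D_XD_YZ-D_YD_XZ-D_{[X,Y]}Z$ and $\mathrm{Ric}^D(X,Y)=\mathrm{trace}(Z\mapsto \mathrm R^D_{Z,X}Y)$. Let $\langle\cdot,\cdot\rangle$ be the conformal inner product of forms induced by $c$ (forms of different degrees are orthogonal), and let $\alpha^\sharp\in TM\otimes L^{k-2}$ be defined by $c(\alpha^\sharp,\cdot)=\alpha$. Then for every $k\in\mathbb R$ and every smooth $1$-form $\alpha\in C^\infty(T^*M\otimes L^k)$ of weight $k$, $$\langle(\mathscr D^D)^2\alpha,\alpha\rangle=\langle\Delta^D\alpha,\alpha\rangle+\mathrm{Ric}^D(\alpha^\sharp,\alpha^\sharp),$$ an equality of densities of weight $2k-4$. -/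

import Mathlib

open scoped Manifold ContDiff Topology

set_option linter.unusedSectionVars false

noncomputable section

namespace ConformalWeyl

section

/- Throughout, `M` is a smooth manifold of dimension `n` without boundary, modelled on `ℝⁿ`. -/
variable {n : ℕ} {M : Type*} [TopologicalSpace M] [ChartedSpace (EuclideanSpace ℝ (Fin n)) M]

/-- The tangent space of the `n`-manifold `M` at `x`. -/
abbrev Tan (n : ℕ) {M : Type*} [TopologicalSpace M] [ChartedSpace (EuclideanSpace ℝ (Fin n)) M]
    (x : M) : Type :=
  TangentSpace (𝓡 n) x

/-- The fibre at `x` of the frame bundle `GL(M)`: the ordered bases of `T_xM`. -/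
abbrev Frame (n : ℕ) {M : Type*} [TopologicalSpace M]
    [ChartedSpace (EuclideanSpace ℝ (Fin n)) M] (x : M) : Type :=
  Module.Basis (Fin n) ℝ (Tan n x)

/-! ### Densities -/

section Twisted

variable {V W U : Type*} [AddCommMonoid V] [Module ℝ V] [AddCommMonoid W] [Module ℝ W]
  [AddCommMonoid U] [Module ℝ U]

/-- `Twisted n x w V` is `V ⊗ L^w` at the point `x`, where `L^w = GL(M) ×_{|det|^{w/n}} ℝ` is the
bundle of densities of weight `w`. As usual for associated bundles, an element is a function `μ`
on frames with `μ (f·A) = |det A|^{-w/n} μ f`. (The matrix `A` taking the frame `f` to the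
frame `f'` has determinant `f.det f'`.) -/
def Twisted (n : ℕ) {M : Type*} [TopologicalSpace M] [ChartedSpace (EuclideanSpace ℝ (Fin n)) M]
    (x : M) (w : ℝ) (V : Type*) [AddCommMonoid V] [Module ℝ V] :
    Submodule ℝ (Frame n x → V) where
  carrier := {μ | ∀ f f' : Frame n x, μ f' = |f.det f'| ^ (-w / n) • μ f}
  add_mem' {μ ν} hμ hν f f' := by
    simp only [Pi.add_apply, smul_add, ← hμ f f', ← hν f f']
  zero_mem' f f' := by simp
  smul_mem' a μ hμ f f' := by
    simp only [Pi.smul_apply, hμ f f', smul_comm a]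

/-- The fibre at `x` of the bundle `L^w` of densities of weight `w`. -/
abbrev Density (n : ℕ) {M : Type*} [TopologicalSpace M]
    [ChartedSpace (EuclideanSpace ℝ (Fin n)) M] (x : M) (w : ℝ) : Type :=
  Twisted n x w ℝ

namespace Twisted

variable {x : M} {w w₁ w₂ : ℝ}

lemma det_ne_zero (f f' : Frame n x) : f.det f' ≠ 0 :=
  (f.isUnit_det f').ne_zero

/-- Transport along an equality of weights. -/
def cast (h : w₁ = w₂) (μ : Twisted n x w₁ V) : Twisted n x w₂ V :=
  ⟨μ.1, fun f f' => h ▸ μ.2 f f'⟩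

/-- The map `V ⊗ L^w → W ⊗ L^w` induced by a linear map `V → W`. -/
def map (B : V →ₗ[ℝ] W) (μ : Twisted n x w V) : Twisted n x w W :=
  ⟨fun f => B (μ.1 f), fun f f' => by
    change B (μ.1 f') = _ • B (μ.1 f)
    rw [μ.2 f f', map_smul]⟩

/-- The element of `V ⊗ L^w` which is equal to `v` in the frame `f₀`. -/
def ofFrame (w : ℝ) (f₀ : Frame n x) (v : V) : Twisted n x w V :=
  ⟨fun f => |f₀.det f| ^ (-w / n) • v, fun f f' => by
    have h : f₀.det f' = f.det f' * f₀.det f := by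
      simp only [Module.Basis.det_apply]
      rw [mul_comm, ← Matrix.det_mul, f₀.toMatrix_mul_toMatrix f f']
    change |f₀.det f'| ^ (-w / n) • v = |f.det f'| ^ (-w / n) • |f₀.det f| ^ (-w / n) • v
    rw [h, abs_mul, Real.mul_rpow (abs_nonneg _) (abs_nonneg _), mul_smul]⟩

/-- The product `(V ⊗ L^{w₁}) × (W ⊗ L^{w₂}) → U ⊗ L^{w₁ + w₂}` induced by a bilinear map
`V × W → U`. -/
def prod (B : V →ₗ[ℝ] W →ₗ[ℝ] U) (μ : Twisted n x w₁ V) (ν : Twisted n x w₂ W) :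
    Twisted n x (w₁ + w₂) U :=
  ⟨fun f => B (μ.1 f) (ν.1 f), fun f f' => by
    change B (μ.1 f') (ν.1 f') = _ • B (μ.1 f) (ν.1 f)
    rw [μ.2 f f', ν.2 f f', map_smul, map_smul, LinearMap.smul_apply, smul_smul,
      ← Real.rpow_add (abs_pos.mpr (det_ne_zero f f'))]
    congr 2
    ring⟩

end Twisted

end Twisted

/-! ### Tensors and forms with weights -/

/-- The multilinear maps `(T_xM)^p → ℝ`, that is `(T*_xM)^{⊗ p}`. -/
abbrev Multi (n : ℕ) {M : Type*} [TopologicalSpace M]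
    [ChartedSpace (EuclideanSpace ℝ (Fin n)) M] (x : M) (p : ℕ) : Type :=
  MultilinearMap ℝ (fun _ : Fin p => Tan n x) ℝ

/-- (Not necessarily continuous) sections of `(T*M)^{⊗ p} ⊗ L^w`. -/
abbrev WTensor (n : ℕ) (M : Type*) [TopologicalSpace M]
    [ChartedSpace (EuclideanSpace ℝ (Fin n)) M] (p : ℕ) (w : ℝ) : Type _ :=
  ∀ x : M, Twisted n x w (Multi n x p)

/-- `p`-forms of weight `w`: (not necessarily continuous) sections of `Λ^p T*M ⊗ L^w`. -/
abbrev WForm (n : ℕ) (M : Type*) [TopologicalSpace M]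
    [ChartedSpace (EuclideanSpace ℝ (Fin n)) M] (p : ℕ) (w : ℝ) : Type _ :=
  ∀ x : M, Twisted n x w ((Tan n x) [⋀^Fin p]→ₗ[ℝ] ℝ)

/-- A `p`-form of weight `w`, seen as a `p`-tensor of weight `w`. -/
def WForm.toTensor {p : ℕ} {w : ℝ} (η : WForm n M p w) : WTensor n M p w :=
  fun x => Twisted.map (AlternatingMap.toMultilinearMapLM (S := ℝ)) (η x)

section Smooth

variable [IsManifold (𝓡 n) ∞ M]

/-- The coordinate frame `(∂₁, …, ∂ₙ)` of the preferred chart at `x`, as a function of the point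
`y`. Where that chart is not defined the value is irrelevant. -/
def coordFrame (x y : M) : Frame n y :=
  open Classical in
  if h : y ∈ (trivializationAt (EuclideanSpace ℝ (Fin n)) (TangentSpace (𝓡 n)) x).baseSet then
    (trivializationAt (EuclideanSpace ℝ (Fin n)) (TangentSpace (𝓡 n)) x).basisAt
      (EuclideanSpace.basisFun (Fin n) ℝ).toBasis h
  else
    (trivializationAt (EuclideanSpace ℝ (Fin n)) (TangentSpace (𝓡 n)) y).basisAt
      (EuclideanSpace.basisFun (Fin n) ℝ).toBasis (FiberBundle.mem_baseSet_trivializationAt' y)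

/-- The component `T(∂_{J 0}, …, ∂_{J (p-1)})` of a weighted tensor in the coordinate frame of the
preferred chart at `x` (which also trivialises `L^w`), as a function of the point `y`. -/
def coordComp {p : ℕ} {w : ℝ} (T : WTensor n M p w) (x : M) (J : Fin p → Fin n) (y : M) : ℝ :=
  (T y).1 (coordFrame x y) fun a => coordFrame x y (J a)

/-- Smoothness of a section of `(T*M)^{⊗ p} ⊗ L^w`. -/
def WTensor.IsSmooth {p : ℕ} {w : ℝ} (T : WTensor n M p w) : Prop :=
  ∀ (x : M) (J : Fin p → Fin n),
    ContMDiffOn (𝓡 n) 𝓘(ℝ, ℝ) ∞ (coordComp T x J)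
      (chartAt (EuclideanSpace ℝ (Fin n)) x).source

/-! ### Conformal structures -/

/-- The Gram matrix `c(f_i, f_j)` of a section `c` of `T*M ⊗ T*M ⊗ L^2`, the values in `L^2` being
trivialised by the frame `f` itself. -/
def gram (c : WTensor n M 2 2) (x : M) (f : Frame n x) : Matrix (Fin n) (Fin n) ℝ :=
  Matrix.of fun i j => (c x).1 f ![f i, f j]

variable (n M) in
/-- A conformal structure on `M`: a smooth symmetric section `c` of `T*M ⊗ T*M ⊗ L^2` with
`c(v, v)` in `L^2_+` for `v ≠ 0`, normalised so that `det c` is the natural isomorphism between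
`Λⁿ T*M ⊗ Λⁿ T*M` and `L^{-2n}`. The metrics of the conformal class are the `l^{-2} c`, with `l`
a positive section of `L`. -/
structure ConformalStructure where
  /-- The section of `T*M ⊗ T*M ⊗ L^2`. -/
  toFun : WTensor n M 2 2
  smooth : toFun.IsSmooth
  symm : ∀ (x : M) (f : Frame n x) (u v : Tan n x),
    (toFun x).1 f ![u, v] = (toFun x).1 f ![v, u]
  pos : ∀ (x : M) (f : Frame n x) (v : Tan n x), v ≠ 0 → 0 < (toFun x).1 f ![v, v]
  normalized : ∀ (x : M) (f : Frame n x), (gram toFun x f).det = 1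

/-! ### Contractions with the conformal structure -/

/-- The map `(u, v) ↦ T(u, v, ·)` for a `(p+2)`-tensor `T`. -/
def curryTwo {p : ℕ} {x : M} :
    Multi n x (p + 2) →ₗ[ℝ] Tan n x →ₗ[ℝ] Tan n x →ₗ[ℝ] Multi n x p where
  toFun T := (multilinearCurryLeftEquiv ℝ (fun _ : Fin (p + 1) => Tan n x) ℝ).toLinearMap ∘ₗ
    T.curryLeft
  map_add' _ _ := rfl
  map_smul' _ _ := rfl

lemma curryTwo_apply {p : ℕ} {x : M} (T : Multi n x (p + 2)) (u v : Tan n x)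
    (m : Fin p → Tan n x) :
    curryTwo T u v m = T (Fin.cons u (Fin.cons v m)) := rfl

section Change

variable {V : Type*} [AddCommMonoid V] [Module ℝ V] {x : M}

lemma bilin_change (B : Tan n x →ₗ[ℝ] Tan n x →ₗ[ℝ] V) (f f' : Frame n x) (i j : Fin n) :
    B (f' i) (f' j) =
      ∑ k, ∑ l, (f.toMatrix f' k i * f.toMatrix f' l j) • B (f k) (f l) := by
  have hi : f' i = ∑ k, f.toMatrix f' k i • f k := (f.sum_toMatrix_smul_self f' i).symm
  have hj : f' j = ∑ k, f.toMatrix f' k j • f k := (f.sum_toMatrix_smul_self f' j).symm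
  rw [hi, hj]
  simp only [map_sum, map_smul, LinearMap.sum_apply, LinearMap.smul_apply, Finset.smul_sum,
    smul_smul]
  rw [Finset.sum_comm]
  simp only [mul_comm]

lemma gram_change (c : WTensor n M 2 2) (f f' : Frame n x) :
    gram c x f' = |f.det f'| ^ (-2 / n : ℝ) •
      ((f.toMatrix f').transpose * gram c x f * f.toMatrix f') := by
  have h2 : ∀ (T : Multi n x 2) (u v : Tan n x), T ![u, v] = curryTwo T u v ![] := by
    intro T u v
    rw [curryTwo_apply]
    rfl
  ext i j
  simp only [gram, Matrix.of_apply, Matrix.smul_apply, Matrix.mul_apply, Matrix.transpose_apply]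
  rw [(c x).2 f f', h2, map_smul, LinearMap.smul_apply, LinearMap.smul_apply,
    bilin_change _ f f' i j]
  simp only [smul_apply, sum_apply, h2, smul_eq_mul,
    Finset.sum_mul]
  rw [Finset.sum_comm]
  congr 1
  refine Finset.sum_congr rfl fun k _ => Finset.sum_congr rfl fun l _ => ?_
  ring

lemma sum_change (N : Matrix (Fin n) (Fin n) ℝ) (B : Tan n x →ₗ[ℝ] Tan n x →ₗ[ℝ] V)
    (f f' : Frame n x) :
    ∑ i, ∑ j, N i j • B (f' i) (f' j) =
      ∑ k, ∑ l, (f.toMatrix f' * N * (f.toMatrix f').transpose) k l • B (f k) (f l) := by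
  simp only [bilin_change B f f', Matrix.mul_apply, Matrix.transpose_apply, Finset.smul_sum,
    Finset.sum_smul, smul_smul, Finset.sum_mul]
  have h : ∀ F : Fin n → Fin n → Fin n → Fin n → V,
      ∑ i, ∑ j, ∑ k, ∑ l, F i j k l = ∑ k, ∑ l, ∑ j, ∑ i, F i j k l := by
    intro F
    calc ∑ i, ∑ j, ∑ k, ∑ l, F i j k l
        = ∑ i, ∑ k, ∑ j, ∑ l, F i j k l :=
          Finset.sum_congr rfl fun i _ => Finset.sum_comm
      _ = ∑ k, ∑ i, ∑ j, ∑ l, F i j k l := Finset.sum_comm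
      _ = ∑ k, ∑ i, ∑ l, ∑ j, F i j k l :=
          Finset.sum_congr rfl fun k _ => Finset.sum_congr rfl fun i _ => Finset.sum_comm
      _ = ∑ k, ∑ l, ∑ i, ∑ j, F i j k l :=
          Finset.sum_congr rfl fun k _ => Finset.sum_comm
      _ = ∑ k, ∑ l, ∑ j, ∑ i, F i j k l :=
          Finset.sum_congr rfl fun k _ => Finset.sum_congr rfl fun l _ => Finset.sum_comm
  rw [h]
  refine Finset.sum_congr rfl fun k _ => Finset.sum_congr rfl fun l _ =>
    Finset.sum_congr rfl fun j _ => Finset.sum_congr rfl fun i _ => ?_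
  congr 1
  ring

lemma gram_inv_change (c : ConformalStructure n M) (f f' : Frame n x) :
    f.toMatrix f' * (gram c.toFun x f')⁻¹ * (f.toMatrix f').transpose =
      |f.det f'| ^ (2 / n : ℝ) • (gram c.toFun x f)⁻¹ := by
  have hd : 0 < |f.det f'| := abs_pos.mpr (Twisted.det_ne_zero f f')
  have hA : IsUnit (f.toMatrix f').det := by
    rw [← Module.Basis.det_apply]
    exact f.isUnit_det f'
  have hAt : IsUnit (f.toMatrix f').transpose.det := by rwa [Matrix.det_transpose]
  have hG : (gram c.toFun x f).det = 1 := c.normalized x f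
  set A := f.toMatrix f' with hAdef
  set G := gram c.toFun x f with hGdef
  have hinv : (gram c.toFun x f')⁻¹ = |f.det f'| ^ (2 / n : ℝ) • (A⁻¹ * G⁻¹ * A.transpose⁻¹) := by
    apply Matrix.inv_eq_right_inv
    rw [gram_change c.toFun f f', Matrix.smul_mul, Matrix.mul_smul, smul_smul,
      ← Real.rpow_add hd, neg_div, neg_add_cancel, Real.rpow_zero, one_smul]
    calc A.transpose * G * A * (A⁻¹ * G⁻¹ * A.transpose⁻¹)
        = A.transpose * (G * (A * A⁻¹) * G⁻¹) * A.transpose⁻¹ := by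
          simp only [Matrix.mul_assoc]
      _ = 1 := by
          rw [Matrix.mul_nonsing_inv A hA, Matrix.mul_one,
            Matrix.mul_nonsing_inv G (by rw [hG]; exact isUnit_one), Matrix.mul_one,
            Matrix.mul_nonsing_inv _ hAt]
  rw [hinv, Matrix.mul_smul, Matrix.smul_mul]
  congr 1
  calc A * (A⁻¹ * G⁻¹ * A.transpose⁻¹) * A.transpose
      = (A * A⁻¹) * G⁻¹ * (A.transpose⁻¹ * A.transpose) := by simp only [Matrix.mul_assoc]
    _ = G⁻¹ := by
        rw [Matrix.mul_nonsing_inv A hA, Matrix.nonsing_inv_mul _ hAt, Matrix.one_mul,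
          Matrix.mul_one]

end Change

section Contract

variable {V : Type*} [AddCommMonoid V] [Module ℝ V] {x : M} {w : ℝ}

/-- The contraction (trace) `tr_c B` of a weighted bilinear map `B` with the conformal structure.
In a frame `f` it is `∑ c^{ij} B(f_i, f_j)`, where `(c^{ij})` is the inverse of the Gram matrix
of `f`; in a `c`-orthonormal frame, with associated section `l` of `L`, it is
`(∑ B(e_i, e_i)) l^{-2}`. -/
def ConformalStructure.contract (c : ConformalStructure n M)
    (B : Twisted n x w (Tan n x →ₗ[ℝ] Tan n x →ₗ[ℝ] V)) : Twisted n x (w - 2) V :=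
  ⟨fun f => ∑ i, ∑ j, (gram c.toFun x f)⁻¹ i j • B.1 f (f i) (f j), fun f f' => by
    change ∑ i, ∑ j, (gram c.toFun x f')⁻¹ i j • B.1 f' (f' i) (f' j) =
      _ • ∑ i, ∑ j, (gram c.toFun x f)⁻¹ i j • B.1 f (f i) (f j)
    rw [sum_change, gram_inv_change, B.2 f f', Finset.smul_sum]
    refine Finset.sum_congr rfl fun k _ => ?_
    rw [Finset.smul_sum]
    refine Finset.sum_congr rfl fun l _ => ?_
    rw [Matrix.smul_apply, LinearMap.smul_apply, LinearMap.smul_apply, smul_eq_mul, smul_smul,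
      smul_smul, mul_right_comm, ← Real.rpow_add (abs_pos.mpr (Twisted.det_ne_zero f f'))]
    congr 3
    ring⟩

lemma ConformalStructure.contract_orthonormal (c : ConformalStructure n M)
    (B : Twisted n x w (Tan n x →ₗ[ℝ] Tan n x →ₗ[ℝ] V)) (f : Frame n x)
    (hf : gram c.toFun x f = 1) :
    (c.contract B).1 f = ∑ i, B.1 f (f i) (f i) := by
  change ∑ i, ∑ j, (gram c.toFun x f)⁻¹ i j • B.1 f (f i) (f j) = _
  simp [hf, Matrix.one_apply]

end Contract

/-- The conformal trace of a `(p+2)`-tensor over its first two arguments. -/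
def ConformalStructure.trace (c : ConformalStructure n M) {p : ℕ} {w : ℝ}
    (T : WTensor n M (p + 2) w) : WTensor n M p (w - 2) :=
  fun x => c.contract (Twisted.map curryTwo (T x))

/-- A `1`-tensor at `x` as a linear form. -/
def covector {x : M} : Multi n x 1 →ₗ[ℝ] Tan n x →ₗ[ℝ] ℝ where
  toFun T :=
    { toFun := fun v => T fun _ => v
      map_add' := fun u v => (MultilinearMap.ofSubsingleton ℝ (Tan n x) ℝ (0 : Fin 1)).symm T
        |>.map_add u v
      map_smul' := fun a v => (MultilinearMap.ofSubsingleton ℝ (Tan n x) ℝ (0 : Fin 1)).symm T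
        |>.map_smul a v }
  map_add' _ _ := rfl
  map_smul' _ _ := rfl

/-- The conformal inner product `⟨α, β⟩ = tr_c (α ⊗ β)` of `1`-forms of weights `w₁`, `w₂`, a
density of weight `w₁ + w₂ - 2`. -/
def ConformalStructure.inner (c : ConformalStructure n M) {w₁ w₂ : ℝ} (α : WTensor n M 1 w₁)
    (β : WTensor n M 1 w₂) (x : M) : Density n x (w₁ + w₂ - 2) :=
  c.contract (Twisted.prod LinearMap.smulRightₗ
    (Twisted.map covector (α x)) (Twisted.map covector (β x)))

/-- The section `α^♯` of `TM ⊗ L^{w-2}` associated to a `1`-form `α` of weight `w` by the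
conformal structure, so that `c(α^♯, ·) = α`. -/
def ConformalStructure.sharp (c : ConformalStructure n M) {w : ℝ} (α : WTensor n M 1 w) (x : M) :
    Twisted n x (w - 2) (Tan n x) :=
  c.contract (Twisted.map (LinearMap.smulRightₗ.flip LinearMap.id ∘ₗ covector) (α x))

/-! ### Connections -/

variable (n M) in
/-- Linear connections on the tangent bundle of `M`; the vector `D_v Z` at `x` is written
`D Z x v`. -/
abbrev Connection : Type _ :=
  CovariantDerivative (𝓡 n) (EuclideanSpace ℝ (Fin n)) (TangentSpace (𝓡 n) : M → Type _)

/-- The vector `D_{∂_i} ∂_j` at `x`, for the coordinate frame of the preferred chart at `x`. -/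
def covCoord (D : Connection n M) (x : M) (i j : Fin n) : Tan n x :=
  D (fun y => coordFrame x y j) x (coordFrame x x i)

/-- The component `(D_{∂_i} T)(∂_{J 0}, …, ∂_{J (p-1)})` at `x` of the covariant derivative of a
section `T` of `(T*M)^{⊗ p} ⊗ L^w`, in the coordinate frame of the preferred chart at `x`. The
connection induced by `D` on `L^w` acts on the section `l^w` of `L^w` which is `1` in the frame
`(∂_j)` by `D_{∂_i} l^w = (w / n) tr (v ↦ D_{∂_i} v) l^w`, because `Lⁿ = |Λⁿ TM|`. -/
def derivComp (D : Connection n M) {p : ℕ} {w : ℝ} (T : WTensor n M p w) (x : M) (i : Fin n)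
    (J : Fin p → Fin n) : ℝ :=
  mvfderiv (𝓡 n) (coordComp T x J) x (coordFrame x x i)
    - ∑ a, (T x).1 (coordFrame x x)
        (Function.update (fun b => coordFrame x x (J b)) a (covCoord D x i (J a)))
    + w / n * (∑ k, (coordFrame x x).coord k (covCoord D x i k)) * coordComp T x J x

/-- The tensor `e^{J 0} ⊗ … ⊗ e^{J (p-1)}`, for the basis `(e^i)` dual to the frame `f`. -/
def dualTensor {p : ℕ} {x : M} (f : Frame n x) (J : Fin p → Fin n) : Multi n x p :=
  (MultilinearMap.mkPiAlgebra ℝ (Fin p) ℝ).compLinearMap fun a => f.coord (J a)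

/-- The covariant derivative `D T`, a section of `T*M ⊗ (T*M)^{⊗ p} ⊗ L^w`, of a section `T` of
`(T*M)^{⊗ p} ⊗ L^w`. The first argument of `D T` is the direction of the derivative. -/
def covDeriv (D : Connection n M) {p : ℕ} {w : ℝ} (T : WTensor n M p w) :
    WTensor n M (p + 1) w :=
  fun x => Twisted.ofFrame w (coordFrame x x)
    (∑ J : Fin (p + 1) → Fin n, derivComp D T x (J 0) (Fin.tail J) •
      dualTensor (coordFrame x x) J)

/-- A Weyl connection on `(M, c)`: a smooth torsion-free linear connection on `TM` with `D c = 0`,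
where `D` acts on `c` as connection on `TM` and on `L`. -/
structure WeylConnection (c : ConformalStructure n M) where
  /-- The connection on `TM`. -/
  conn : Connection n M
  smooth : CovariantDerivative.ContMDiffCovariantDerivative conn ∞
  torsion_eq_zero : conn.torsion = 0
  parallel : covDeriv conn c.toFun = 0

/-- The curvature `R_{X,Y} Z = D_X D_Y Z - D_Y D_X Z - D_{[X,Y]} Z`. -/
def curvature (D : Connection n M) (X Y Z : ∀ x : M, Tan n x) (x : M) : Tan n x :=
  D (fun y => D Z y (Y y)) x (X x) - D (fun y => D Z y (X y)) x (Y x)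
    - D Z x (VectorField.mlieBracket (𝓡 n) X Y x)

/-- The Ricci curvature `Ric(X, Y) = trace (Z ↦ R_{Z,X} Y)`. It is computed on the coordinate
vector fields of the preferred chart at `x` and extended bilinearly. -/
def ricci (D : Connection n M) (x : M) : Tan n x →ₗ[ℝ] Tan n x →ₗ[ℝ] ℝ :=
  (coordFrame x x).constr ℝ fun i => (coordFrame x x).constr ℝ fun j =>
    ∑ k, (coordFrame x x).coord k
      (curvature D (fun y => coordFrame x y k) (fun y => coordFrame x y i)
        (fun y => coordFrame x y j) x)

/-! ### The operators `d^D`, `δ^D`, `Δ^D` and the Weyl–Dirac operator -/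

/-- The exterior derivative `d^D η = ∑ e_i^* ∧ D_{e_i} η`. It is the antisymmetrisation of `D η`,
because `e_i^* ∧ ψ = (1 / p!) ∑_σ sign(σ) (e_i^* ⊗ ψ) ∘ σ` for a `p`-form `ψ`. -/
def weylExtDeriv (D : Connection n M) {p : ℕ} {w : ℝ} (η : WForm n M p w) : WForm n M (p + 1) w :=
  fun x => ⟨fun f => (p.factorial : ℝ)⁻¹ •
      MultilinearMap.alternatization ((covDeriv D η.toTensor x).1 f), fun f f' => by
    have h := (covDeriv D η.toTensor x).2 f f'
    ext v
    simp only [AlternatingMap.smul_apply, MultilinearMap.alternatization_apply, h,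
      MultilinearMap.domDomCongr_apply, smul_apply, Finset.smul_sum]
    refine Finset.sum_congr rfl fun σ _ => ?_
    simp only [smul_eq_mul, Units.smul_def, zsmul_eq_mul]
    ring⟩

lemma coordComp_toTensor_comp {p : ℕ} {w : ℝ} (η : WForm n M p w) (x : M)
    (J : Fin p → Fin n) (i j : Fin p) (hij : i ≠ j) (y : M) :
    coordComp η.toTensor x (J ∘ Equiv.swap i j) y = -coordComp η.toTensor x J y :=
  AlternatingMap.map_swap ((η y).1 (coordFrame x y)) (fun a => coordFrame x y (J a)) hij

lemma derivComp_toTensor_comp (D : Connection n M) {p : ℕ} {w : ℝ} (η : WForm n M p w) (x : M)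
    (k : Fin n) (J : Fin p → Fin n) (i j : Fin p) (hij : i ≠ j) :
    derivComp D η.toTensor x k (J ∘ Equiv.swap i j) = -derivComp D η.toTensor x k J := by
  have h1 : coordComp η.toTensor x (J ∘ Equiv.swap i j) = -coordComp η.toTensor x J :=
    funext fun y => coordComp_toTensor_comp η x J i j hij y
  have h2 : ∀ a, (η.toTensor x).1 (coordFrame x x)
        (Function.update (fun b => coordFrame x x ((J ∘ Equiv.swap i j) b)) a
          (covCoord D x k ((J ∘ Equiv.swap i j) a))) =
      -(η.toTensor x).1 (coordFrame x x)
        (Function.update (fun b => coordFrame x x (J b)) (Equiv.swap i j a)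
          (covCoord D x k (J (Equiv.swap i j a)))) := by
    intro a
    have hu := Function.update_comp_equiv (fun b => coordFrame x x (J b)) (Equiv.swap i j)
      (Equiv.swap i j a) (covCoord D x k (J (Equiv.swap i j a)))
    rw [Equiv.symm_apply_apply] at hu
    change (η x).1 (coordFrame x x) (Function.update ((fun b => coordFrame x x (J b)) ∘
      Equiv.swap i j) a (covCoord D x k (J (Equiv.swap i j a)))) = _
    rw [← hu]
    exact AlternatingMap.map_swap ((η x).1 (coordFrame x x)) _ hij
  have h3 : mvfderiv (𝓡 n) (-coordComp η.toTensor x J) x =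
      -mvfderiv (𝓡 n) (coordComp η.toTensor x J) x := by
    ext v
    rw [mvfderiv, mfderiv_neg]
    rfl
  unfold derivComp
  rw [h1, h3, Finset.sum_congr rfl fun a _ => h2 a, Finset.sum_neg_distrib,
    Equiv.sum_comp (Equiv.swap i j) fun a => (η.toTensor x).1 (coordFrame x x)
        (Function.update (fun b => coordFrame x x (J b)) a (covCoord D x k (J a)))]
  simp only [neg_apply, Pi.neg_apply]
  ring

/-- If `η` is a form, then so is `D_u η`. -/
lemma covDeriv_toTensor_eq_zero (D : Connection n M) {p : ℕ} {w : ℝ} (η : WForm n M p w) (x : M)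
    (f : Frame n x) (u : Tan n x) (v : Fin p → Tan n x) (i j : Fin p) (hv : v i = v j)
    (hij : i ≠ j) : (covDeriv D η.toTensor x).1 f (Fin.cons u v) = 0 := by
  change (_ • ∑ J : Fin (p + 1) → Fin n, derivComp D η.toTensor x (J 0) (Fin.tail J) •
      dualTensor (coordFrame x x) J : Multi n x (p + 1)) (Fin.cons u v) = 0
  rw [smul_apply]
  refine smul_eq_zero_of_right _ ?_
  rw [sum_apply]
  let σ : Equiv.Perm (Fin (p + 1)) := Equiv.swap i.succ j.succ
  have hσv : ∀ a, (Fin.cons u v : Fin (p + 1) → Tan n x) (σ a) =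
      (Fin.cons u v : Fin (p + 1) → Tan n x) a := by
    intro a
    by_cases h1 : a = i.succ
    · subst h1; simp [σ, hv]
    by_cases h2 : a = j.succ
    · subst h2; simp [σ, hv]
    simp only [σ, Equiv.swap_apply_of_ne_of_ne h1 h2]
  have hterm : ∀ J : Fin (p + 1) → Fin n,
      (derivComp D η.toTensor x ((J ∘ σ) 0) (Fin.tail (J ∘ σ)) •
        dualTensor (coordFrame x x) (J ∘ σ)) (Fin.cons u v) =
      -(derivComp D η.toTensor x (J 0) (Fin.tail J) •
        dualTensor (coordFrame x x) J) (Fin.cons u v) := by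
    intro J
    have h0 : (J ∘ σ) 0 = J 0 := by
      simp only [σ, Function.comp_apply]
      rw [Equiv.swap_apply_of_ne_of_ne (Fin.succ_ne_zero i).symm (Fin.succ_ne_zero j).symm]
    have ht : Fin.tail (J ∘ σ) = Fin.tail J ∘ Equiv.swap i j := by
      funext a
      simp only [Fin.tail, σ, Function.comp_apply]
      rw [(Fin.succ_injective p).swap_apply i j a]
    have hd : dualTensor (coordFrame x x) (J ∘ σ) (Fin.cons u v) =
        dualTensor (coordFrame x x) J (Fin.cons u v) := by
      simp only [dualTensor, MultilinearMap.compLinearMap_apply, MultilinearMap.mkPiAlgebra_apply]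
      rw [← Equiv.prod_comp σ fun a => (coordFrame x x).coord (J a)
        ((Fin.cons u v : Fin (p + 1) → Tan n x) a)]
      simp only [hσv, Function.comp_apply]
    rw [smul_apply, smul_apply, h0, ht, hd, derivComp_toTensor_comp D η x _ _ i j hij, neg_smul]
  refine Finset.sum_involution (fun J _ => J ∘ σ) ?_ ?_ (fun _ _ => Finset.mem_univ _) ?_
  · intro J _
    rw [hterm J, add_neg_cancel]
  · intro J _ hJ h
    have := hterm J
    rw [h] at this
    exact hJ (self_eq_neg.mp this)
  · intro J _
    funext a
    simp [σ]

/-- The conformal divergence `δ^D η = -(∑ e_i ⌟ D_{e_i} η) l^{-2}`, that is `-tr_c` of `D η` over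
its first two arguments. -/
def divergence (c : ConformalStructure n M) (D : Connection n M) {p : ℕ} {w : ℝ}
    (η : WForm n M (p + 1) w) : WForm n M p (w - 2) :=
  fun x => ⟨fun f =>
    { toMultilinearMap := -(c.trace (covDeriv D η.toTensor) x).1 f
      map_eq_zero_of_eq' := by
        intro v i j hv hij
        change -(∑ k, ∑ l, (gram c.toFun x f)⁻¹ k l •
          curryTwo ((covDeriv D η.toTensor x).1 f) (f k) (f l) : Multi n x p) v = 0
        simp only [sum_apply, smul_apply, curryTwo_apply]
        rw [neg_eq_zero]
        refine Finset.sum_eq_zero fun k _ => Finset.sum_eq_zero fun l _ => ?_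
        rw [covDeriv_toTensor_eq_zero D η x f (f k) (Fin.cons (f l) v) i.succ j.succ
          (by simpa using hv) (by simpa using hij), smul_zero] }, fun f f' => by
    ext v
    have h := congrArg (fun T : Multi n x p => -T v)
      ((c.trace (covDeriv D η.toTensor) x).2 f f')
    simp only [smul_apply, smul_eq_mul] at h
    change -(c.trace (covDeriv D η.toTensor) x).1 f' v =
      _ * -(c.trace (covDeriv D η.toTensor) x).1 f v
    rw [h, mul_neg]⟩

/-- The Laplacian `Δ^D = -tr_c (D ∘ D)`. -/
def laplacian (c : ConformalStructure n M) (D : Connection n M) {p : ℕ} {w : ℝ}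
    (T : WTensor n M p w) : WTensor n M p (w - 2) :=
  -c.trace (covDeriv D (covDeriv D T))

variable (n M) in
/-- Inhomogeneous forms: families `Ω` of forms `Ω p w` of degree `p` and weight `w`, to be thought
of as the formal sum of the `Ω p w`. -/
abbrev MixedForm : Type _ := ∀ (p : ℕ) (w : ℝ), WForm n M p w

/-- A `p`-form of weight `w` as an inhomogeneous form. -/
def WForm.toMixed {p : ℕ} {w : ℝ} (η : WForm n M p w) : MixedForm n M :=
  open Classical in Pi.single p (Pi.single w η)

/-- The Weyl–Dirac operator `𝒟^D = d^D + δ^D`. The component of degree `p` and weight `w` of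
`𝒟^D Ω` is the sum of `d^D` of the component of degree `p - 1` and weight `w`, and of `δ^D` of the
component of degree `p + 1` and weight `w + 2`. -/
def weylDirac (c : ConformalStructure n M) (D : Connection n M) (Ω : MixedForm n M) :
    MixedForm n M
  | 0, w => fun x => Twisted.cast (by ring) (divergence c D (Ω 1 (w + 2)) x)
  | p + 1, w => weylExtDeriv D (Ω p w) +
      fun x => Twisted.cast (by ring) (divergence c D (Ω (p + 2) (w + 2)) x)

variable (n M) in
/-- Formal sums of densities of various weights. -/
abbrev MixedDensity : Type _ := ∀ (w : ℝ) (x : M), Density n x w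

/-- The conformal inner product `⟨Ω, α⟩` of an inhomogeneous form with a `1`-form `α` of weight `k`.
Forms of different degrees being orthogonal, only the components `Ω 1 w` contribute; `⟨Ω 1 w, α⟩`
is the component of `⟨Ω, α⟩` of weight `w + k - 2`. -/
def ConformalStructure.innerMixed (c : ConformalStructure n M) (Ω : MixedForm n M) {k : ℝ}
    (α : WForm n M 1 k) : MixedDensity n M :=
  fun w x => Twisted.cast (by ring) (c.inner (Ω 1 (w - k + 2)).toTensor α.toTensor x)

/-- The density `Ric^D(α^♯, α^♯)` of weight `2 k - 4`, for a `1`-form `α` of weight `k`. -/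
def ricciSharp (c : ConformalStructure n M) (D : Connection n M) {k : ℝ} (α : WTensor n M 1 k)
    (x : M) : Density n x (2 * k - 4) :=
  Twisted.cast (by ring) (Twisted.prod (ricci D x) (c.sharp α x) (c.sharp α x))

/-- The density `⟨Δ^D α, α⟩` of weight `2 k - 4`, for a `1`-form `α` of weight `k`. -/
def innerLaplacian (c : ConformalStructure n M) (D : Connection n M) {k : ℝ}
    (α : WTensor n M 1 k) (x : M) : Density n x (2 * k - 4) :=
  Twisted.cast (by ring) (c.inner (laplacian c D α) α x)

end Smooth

end

end ConformalWeyl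

end

open ConformalWeyl

noncomputable section

namespace ConformalWeyl

/-! ### Coordinate frames, partial derivatives in a chart, and the brackets of coordinate fields -/

section Frames

variable {n : ℕ} {M : Type*} [TopologicalSpace M] [ChartedSpace (EuclideanSpace ℝ (Fin n)) M]

/-! On a 1-form the degree-one part of the squared Weyl–Dirac operator is `dδ + δd`, and only this
part pairs with `α`. Write `h` for the inverse of `c`. Since `Dc = 0`, `h` is parallel too and can
be pulled out of derivatives (`pd_inverse_metric`, `covZero_contract`). Hence `(dδα)_j = -h^{pi} D_j
D_p α_i`, while `(δdα)_j = -h^{pi}(D_p D_i α_j - D_p D_j α_i)`. The sum is `(Δα)_j` plus the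
contracted commutator `h^{pi}(D_p D_j - D_j D_p)α_i`.

The Ricci identity (`ricci_identity`, where torsion-freeness enters) writes this commutator as the
curvature of `TM` acting on `α` plus `k/n` times the trace curvature `F`, the curvature of the
density bundles. Commuting two derivatives of `c` (`curvSymbol_metric`) shows that `R_{pj}` is skew
for `c` up to the multiple `(2/n) F_{pj}`. This moves the free index of `R` and yields, with `v =
α^♯`, the covector `R_{pji}^p v^i + ((k-2)/n) F_{pj} v^p`. Pairing with `v` turns the first term
into `Ric(v, v)` and kills the second because `F` is skew (`curvature_term`). So the weight leaves
no trace in the formula.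

These computations are done with functions on `ℝⁿ` in the chart centred at a point `x`. The
geometric work is to justify them: `covDeriv` is defined at each `y` through the chart preferred at
`y`, whereas differentiating twice needs the components of `Dα` near `x` in the single chart at `x`.
This is `coordComp_covDeriv`. Its proof rests on a Leibniz expression `leibDeriv` for arbitrary
vector fields, which is tensorial in these fields and changes as a density under change of
coordinate frame, by Jacobi's formula. The second derivatives are needed at `x` only, where no
comparison of charts is required; so `Dα`, `dα` and `δα` never have to be shown smooth as tensors.
-/

lemma Twisted.ext_frame {V : Type*} [AddCommMonoid V] [Module ℝ V] {x : M} {w : ℝ}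
    {μ ν : Twisted n x w V} (f : Frame n x) (h : μ.1 f = ν.1 f) : μ = ν :=
  Subtype.ext <| funext fun f' => by rw [μ.2 f f', ν.2 f f', h]

variable [IsManifold (𝓡 n) ∞ M]

lemma coordFrame_apply {x y : M} (h : y ∈ (chartAt (EuclideanSpace ℝ (Fin n)) x).source)
    (i : Fin n) :
    coordFrame x y i = (trivializationAt (EuclideanSpace ℝ (Fin n)) (TangentSpace (𝓡 n)) x).symmL ℝ
      y (EuclideanSpace.basisFun (Fin n) ℝ i) := by
  have h' : y ∈ (trivializationAt (EuclideanSpace ℝ (Fin n)) (TangentSpace (𝓡 n)) x).baseSet := h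
  rw [coordFrame, dif_pos h']
  rw [Bundle.Trivialization.symmL_apply _ h']
  simp [Bundle.Trivialization.basisAt]

lemma coordFrame_eq_localFrame {x y : M}
    (h : y ∈ (chartAt (EuclideanSpace ℝ (Fin n)) x).source) (i : Fin n) :
    coordFrame x y i =
      (trivializationAt (EuclideanSpace ℝ (Fin n)) (TangentSpace (𝓡 n)) x).localFrame
        (EuclideanSpace.basisFun (Fin n) ℝ).toBasis i y := by
  have h' : y ∈ (trivializationAt (EuclideanSpace ℝ (Fin n)) (TangentSpace (𝓡 n)) x).baseSet := h
  rw [coordFrame, dif_pos h', Bundle.Trivialization.localFrame_apply_of_mem_baseSet _ _ h']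

lemma contMDiffOn_coordFrame (x : M) (i : Fin n) :
    ContMDiffOn (𝓡 n) ((𝓡 n).prod 𝓘(ℝ, EuclideanSpace ℝ (Fin n))) ∞
      (fun y => (⟨y, coordFrame x y i⟩ : TangentBundle (𝓡 n) M))
      (chartAt (EuclideanSpace ℝ (Fin n)) x).source := by
  refine ((trivializationAt (EuclideanSpace ℝ (Fin n)) (TangentSpace (𝓡 n) : M → Type _)
    x).contMDiffOn_localFrame_baseSet ∞
      (EuclideanSpace.basisFun (Fin n) ℝ).toBasis i).congr ?_
  intro y hy
  rw [coordFrame_eq_localFrame hy]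

lemma contMDiffAt_coordFrame {x y : M} (h : y ∈ (chartAt (EuclideanSpace ℝ (Fin n)) x).source)
    (i : Fin n) :
    ContMDiffAt (𝓡 n) ((𝓡 n).prod 𝓘(ℝ, EuclideanSpace ℝ (Fin n))) ∞
      (fun y => (⟨y, coordFrame x y i⟩ : TangentBundle (𝓡 n) M)) y :=
  (contMDiffOn_coordFrame x i).contMDiffAt ((chartAt _ x).open_source.mem_nhds h)

lemma mdifferentiableAt_coordFrame {x y : M}
    (h : y ∈ (chartAt (EuclideanSpace ℝ (Fin n)) x).source) (i : Fin n) :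
    MDifferentiableAt (𝓡 n) ((𝓡 n).prod 𝓘(ℝ, EuclideanSpace ℝ (Fin n)))
      (fun y => (⟨y, coordFrame x y i⟩ : TangentBundle (𝓡 n) M)) y :=
  (contMDiffAt_coordFrame h i).mdifferentiableAt (by simp)

lemma coordFrame_coord {x y : M} (h : y ∈ (chartAt (EuclideanSpace ℝ (Fin n)) x).source)
    (i : Fin n) (Z : ∀ y : M, Tan n y) :
    (coordFrame x y).coord i (Z y) =
      (trivializationAt (EuclideanSpace ℝ (Fin n)) (TangentSpace (𝓡 n)) x).localFrameCoeff (𝓡 n)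
        (EuclideanSpace.basisFun (Fin n) ℝ).toBasis i y (Z y) := by
  have h' : y ∈ (trivializationAt (EuclideanSpace ℝ (Fin n)) (TangentSpace (𝓡 n)) x).baseSet := h
  rw [Bundle.Trivialization.localFrameCoeff_apply_of_mem_baseSet _ _ h', coordFrame, dif_pos h']
  rfl

lemma contMDiffAt_coordFrame_coord {x y : M}
    (h : y ∈ (chartAt (EuclideanSpace ℝ (Fin n)) x).source) (i : Fin n) {Z : ∀ y : M, Tan n y}
    (hZ : ContMDiffAt (𝓡 n) ((𝓡 n).prod 𝓘(ℝ, EuclideanSpace ℝ (Fin n))) ∞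
      (fun y => (⟨y, Z y⟩ : TangentBundle (𝓡 n) M)) y) :
    ContMDiffAt (𝓡 n) 𝓘(ℝ, ℝ) ∞ (fun z => (coordFrame x z).coord i (Z z)) y := by
  have h' : y ∈ (trivializationAt (EuclideanSpace ℝ (Fin n)) (TangentSpace (𝓡 n)) x).baseSet := h
  refine (contMDiffAt_localFrameCoeff (EuclideanSpace.basisFun (Fin n) ℝ).toBasis h' hZ
    i).congr_of_eventuallyEq ?_
  filter_upwards [(chartAt _ x).open_source.mem_nhds h] with z hz
  exact coordFrame_coord hz i Z

lemma mdifferentiableAt_coordFrame_coord {x y : M}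
    (h : y ∈ (chartAt (EuclideanSpace ℝ (Fin n)) x).source) (i : Fin n) {Z : ∀ y : M, Tan n y}
    (hZ : MDifferentiableAt (𝓡 n) ((𝓡 n).prod 𝓘(ℝ, EuclideanSpace ℝ (Fin n)))
      (fun y => (⟨y, Z y⟩ : TangentBundle (𝓡 n) M)) y) :
    MDifferentiableAt (𝓡 n) 𝓘(ℝ, ℝ) (fun z => (coordFrame x z).coord i (Z z)) y := by
  have h' : y ∈ (trivializationAt (EuclideanSpace ℝ (Fin n)) (TangentSpace (𝓡 n)) x).baseSet := h
  refine (mdifferentiableAt_localFrameCoeff (EuclideanSpace.basisFun (Fin n) ℝ).toBasis h' hZ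
    i).congr_of_eventuallyEq ?_
  filter_upwards [(chartAt _ x).open_source.mem_nhds h] with z hz
  exact coordFrame_coord hz i Z

/-- The derivative along a coordinate vector field is a partial derivative in the chart. -/
lemma mvfderiv_coordFrame {x y : M} (h : y ∈ (chartAt (EuclideanSpace ℝ (Fin n)) x).source)
    (i : Fin n) {f : M → ℝ} (hf : MDifferentiableAt (𝓡 n) 𝓘(ℝ, ℝ) f y) :
    mvfderiv (𝓡 n) f y (coordFrame x y i) =
      fderiv ℝ (f ∘ (extChartAt (𝓡 n) x).symm) (extChartAt (𝓡 n) x y)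
        (EuclideanSpace.basisFun (Fin n) ℝ i) := by
  have hsymm : MDifferentiableWithinAt 𝓘(ℝ, EuclideanSpace ℝ (Fin n)) (𝓡 n)
      (extChartAt (𝓡 n) x).symm (Set.range (𝓡 n)) (extChartAt (𝓡 n) x y) :=
    mdifferentiableWithinAt_extChartAt_symm ((extChartAt (𝓡 n) x).map_source (by simpa using h))
  have hy : (extChartAt (𝓡 n) x).symm (extChartAt (𝓡 n) x y) = y :=
    (extChartAt (𝓡 n) x).left_inv (by simpa using h)
  have hr : Set.range (𝓡 n) = Set.univ := by simp
  rw [coordFrame_apply h, TangentBundle.symmL_trivializationAt h]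
  rw [hr, mdifferentiableWithinAt_univ] at hsymm
  rw [hr, mfderivWithin_univ]
  have := mfderiv_comp_of_eq (I := 𝓘(ℝ, EuclideanSpace ℝ (Fin n))) (I' := 𝓡 n) (I'' := 𝓘(ℝ, ℝ))
    (x := extChartAt (𝓡 n) x y) (g := f) hf hsymm hy
  rw [← mfderiv_eq_fderiv, this, hy]
  rfl

lemma contDiffAt_chart {x y : M}
    (h : y ∈ (chartAt (EuclideanSpace ℝ (Fin n)) x).source)
    {f : M → ℝ} (hf : ContMDiffAt (𝓡 n) 𝓘(ℝ, ℝ) ∞ f y) :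
    ContDiffAt ℝ ∞ (f ∘ (extChartAt (𝓡 n) x).symm) (extChartAt (𝓡 n) x y) := by
  have hsymm : ContMDiffWithinAt 𝓘(ℝ, EuclideanSpace ℝ (Fin n)) (𝓡 n) ∞
      (extChartAt (𝓡 n) x).symm (Set.range (𝓡 n)) (extChartAt (𝓡 n) x y) :=
    contMDiffWithinAt_extChartAt_symm_range x
      ((extChartAt (𝓡 n) x).map_source (by simpa using h))
  have hy : (extChartAt (𝓡 n) x).symm (extChartAt (𝓡 n) x y) = y :=
    (extChartAt (𝓡 n) x).left_inv (by simpa using h)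
  have hr : Set.range (𝓡 n) = Set.univ := by simp
  rw [hr, contMDiffWithinAt_univ] at hsymm
  rw [← contMDiffAt_iff_contDiffAt]
  exact ContMDiffAt.comp_of_eq (I' := 𝓡 n) hf hsymm hy

/-- Near `x` the coordinate fields are pullbacks of constant fields under the chart. The bracket
commutes with pullback, and constant fields commute. -/
lemma mlieBracket_coordFrame (x : M) (i j : Fin n) :
    VectorField.mlieBracket (𝓡 n) (fun y => coordFrame x y i) (fun y => coordFrame x y j) x = 0 := by
  have : IsManifold (𝓡 n) (minSmoothness ℝ 2) M := by
    rw [minSmoothness_of_isRCLikeNormedField]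
    infer_instance
  let V (i : Fin n) : ∀ z : EuclideanSpace ℝ (Fin n), TangentSpace 𝓘(ℝ, EuclideanSpace ℝ (Fin n)) z :=
    fun _ => EuclideanSpace.basisFun (Fin n) ℝ i
  have hV (i : Fin n) : ∀ᶠ y in 𝓝 x, coordFrame x y i =
      VectorField.mpullback (𝓡 n) 𝓘(ℝ, EuclideanSpace ℝ (Fin n)) (extChartAt (𝓡 n) x) (V i) y := by
    filter_upwards [(chartAt _ x).open_source.mem_nhds
      (mem_chart_source (EuclideanSpace ℝ (Fin n)) x)] with y hy
    rw [coordFrame_apply hy, VectorField.mpullback,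
      ← TangentBundle.continuousLinearMapAt_trivializationAt hy]
    have h' : y ∈ (trivializationAt (EuclideanSpace ℝ (Fin n)) (TangentSpace (𝓡 n)) x).baseSet := hy
    have hinv : ContinuousLinearMap.inverse ((trivializationAt (EuclideanSpace ℝ (Fin n))
        (TangentSpace (𝓡 n)) x).continuousLinearMapAt ℝ y) = (trivializationAt
          (EuclideanSpace ℝ (Fin n)) (TangentSpace (𝓡 n)) x).symmL ℝ y := by
      refine ContinuousLinearMap.inverse_eq ?_ ?_
      · refine ContinuousLinearMap.ext fun v => ?_
        exact Bundle.Trivialization.continuousLinearMapAt_symmL _ h' v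
      · refine ContinuousLinearMap.ext fun v => ?_
        exact Bundle.Trivialization.symmL_continuousLinearMapAt _ h' v
    exact congr($hinv.symm (EuclideanSpace.basisFun (Fin n) ℝ i))
  have hVd (i : Fin n) : MDifferentiableAt 𝓘(ℝ, EuclideanSpace ℝ (Fin n))
      (𝓘(ℝ, EuclideanSpace ℝ (Fin n)).prod 𝓘(ℝ, EuclideanSpace ℝ (Fin n)))
      (fun z => (⟨z, V i z⟩ : TangentBundle 𝓘(ℝ, EuclideanSpace ℝ (Fin n))
        (EuclideanSpace ℝ (Fin n)))) (extChartAt (𝓡 n) x x) := by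
    refine ContMDiffAt.mdifferentiableAt (n := 1) ?_ (by simp)
    exact contMDiffAt_vectorSpace_iff_contDiffAt.2 contDiffAt_const
  rw [Filter.EventuallyEq.mlieBracket_vectorField_eq (hV i) (hV j),
    ← VectorField.mpullback_mlieBracket (n := ∞) (hVd i) (hVd j) contMDiffAt_extChartAt
      (by rw [minSmoothness_of_isRCLikeNormedField]; exact WithTop.coe_le_coe.2 (le_top : (2 : ℕ∞) ≤ ⊤)),
    VectorField.mpullback, ← VectorField.mlieBracketWithin_univ,
    VectorField.mlieBracketWithin_eq_lieBracketWithin]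
  have h0 : VectorField.lieBracketWithin ℝ (V i) (V j) Set.univ (extChartAt (𝓡 n) x x) = 0 := by
    simp [VectorField.lieBracket, V]
  rw [h0]
  exact map_zero _

end Frames

/-! ### The Leibniz expression for the covariant derivative and its tensoriality -/

section Leibniz

variable {n : ℕ} {M : Type*} [TopologicalSpace M] [ChartedSpace (EuclideanSpace ℝ (Fin n)) M]

lemma mdifferentiableAt_finset_prod {ι : Type*} {s : Finset ι} {f : ι → M → ℝ} {y : M}
    (h : ∀ i ∈ s, MDifferentiableAt (𝓡 n) 𝓘(ℝ, ℝ) (f i) y) :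
    MDifferentiableAt (𝓡 n) 𝓘(ℝ, ℝ) (fun z => ∏ i ∈ s, f i z) y := by
  classical
  induction s using Finset.induction_on with
  | empty => simpa using! mdifferentiableAt_const
  | insert a s ha ih =>
    simp only [Finset.prod_insert ha]
    exact (h a (by simp)).mul (ih fun i hi => h i (by simp [hi]))

lemma mdifferentiableAt_finset_sum {ι : Type*} {s : Finset ι} {f : ι → M → ℝ} {y : M}
    (h : ∀ i ∈ s, MDifferentiableAt (𝓡 n) 𝓘(ℝ, ℝ) (f i) y) :
    MDifferentiableAt (𝓡 n) 𝓘(ℝ, ℝ) (fun z => ∑ i ∈ s, f i z) y := by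
  classical
  induction s using Finset.induction_on with
  | empty => simpa using! mdifferentiableAt_const
  | insert a s ha ih =>
    simp only [Finset.sum_insert ha]
    exact (h a (by simp)).add (ih fun i hi => h i (by simp [hi]))

lemma multi_expand {p : ℕ} {x : M} (f : Frame n x) (T : Multi n x p) (v : Fin p → Tan n x) :
    T v = ∑ J : Fin p → Fin n, (∏ a, f.coord (J a) (v a)) * T fun a => f (J a) := by
  have hv : v = fun a => ∑ k, f.coord k (v a) • f k := by
    funext a
    simp
  conv_lhs => rw [hv]
  rw [MultilinearMap.map_sum]
  simp only [MultilinearMap.map_smul_univ, smul_eq_mul]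

variable [IsManifold (𝓡 n) ∞ M]

lemma mdifferentiableAt_coordComp {p : ℕ} {w : ℝ} {T : WTensor n M p w} (hT : T.IsSmooth)
    {x y : M} (h : y ∈ (chartAt (EuclideanSpace ℝ (Fin n)) x).source) (J : Fin p → Fin n) :
    MDifferentiableAt (𝓡 n) 𝓘(ℝ, ℝ) (coordComp T x J) y :=
  ((hT x J).contMDiffAt ((chartAt _ x).open_source.mem_nhds h)).mdifferentiableAt (by simp)

lemma mdifferentiableAt_eval {p : ℕ} {w : ℝ} {T : WTensor n M p w} (hT : T.IsSmooth)
    {x y : M} (h : y ∈ (chartAt (EuclideanSpace ℝ (Fin n)) x).source)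
    {X : Fin p → ∀ y : M, Tan n y}
    (hX : ∀ a, MDifferentiableAt (𝓡 n) ((𝓡 n).prod 𝓘(ℝ, EuclideanSpace ℝ (Fin n)))
      (fun y => (⟨y, X a y⟩ : TangentBundle (𝓡 n) M)) y) :
    MDifferentiableAt (𝓡 n) 𝓘(ℝ, ℝ) (fun z => (T z).1 (coordFrame x z) fun a => X a z) y := by
  have : (fun z => (T z).1 (coordFrame x z) fun a => X a z) = fun z =>
      ∑ J : Fin p → Fin n, (∏ a, (coordFrame x z).coord (J a) (X a z)) * coordComp T x J z :=
    funext fun z => multi_expand _ _ _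
  rw [this]
  exact mdifferentiableAt_finset_sum fun J _ => (mdifferentiableAt_finset_prod fun a _ =>
    mdifferentiableAt_coordFrame_coord h (J a) (hX a)).mul (mdifferentiableAt_coordComp hT h J)

/-- The covariant derivative of a weighted tensor evaluated on vector fields `X`, where `L^w` is
trivialised by the frame field `F`, computed with the Leibniz rule. -/
def leibDeriv (D : Connection n M) {p : ℕ} {w : ℝ} (T : WTensor n M p w)
    (F : ∀ y : M, Frame n y) (X : Fin p → ∀ y : M, Tan n y) (y : M) (u : Tan n y) : ℝ :=
  mvfderiv (𝓡 n) (fun z => (T z).1 (F z) fun a => X a z) y u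
    - ∑ a, (T y).1 (F y) (Function.update (fun b => X b y) a (D (X a) y u))
    + w / n * (∑ k, (F y).coord k (D (fun z => F z k) y u)) * (T y).1 (F y) fun a => X a y

/-- Isolates the dependence on the field in slot `a`: of the correction terms only one
differentiates `Z`, the others involve just its value. -/
lemma leibDeriv_update (D : Connection n M) {p : ℕ} {w : ℝ} (T : WTensor n M p w)
    (F : ∀ y : M, Frame n y) (X : Fin p → ∀ y : M, Tan n y) (y : M) (u : Tan n y) (a : Fin p)
    (Z : ∀ y : M, Tan n y) :
    leibDeriv D T F (Function.update X a Z) y u =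
      mvfderiv (𝓡 n) (fun z => (T z).1 (F z) (Function.update (fun b => X b z) a (Z z))) y u
      - ((T y).1 (F y) (Function.update (fun b => X b y) a (D Z y u)) +
        ∑ b ∈ Finset.univ.erase a, (T y).1 (F y)
          (Function.update (Function.update (fun b => X b y) b (D (X b) y u)) a (Z y)))
      + w / n * (∑ k, (F y).coord k (D (fun z => F z k) y u)) *
        (T y).1 (F y) (Function.update (fun b => X b y) a (Z y)) := by
  have hev (z : M) : (fun b => Function.update X a Z b z) =
      Function.update (fun b => X b z) a (Z z) := by
    funext b
    by_cases hb : b = a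
    · subst hb; simp
    · simp [hb]
  unfold leibDeriv
  simp only [hev]
  rw [← Finset.add_sum_erase _ _ (Finset.mem_univ a)]
  simp only [Function.update_self, Function.update_idem]
  rw [Finset.sum_congr rfl fun b hb => ?_]
  rw [Function.update_of_ne (Finset.ne_of_mem_erase hb),
    Function.update_comm (Finset.ne_of_mem_erase hb).symm]

/-- On replacing `Z` by `f Z`, the term `df(u) T(…, Z, …)` from the derivative of the evaluated
tensor cancels the one from `D(f Z) = f DZ + df ⊗ Z`. The density term is already linear in the
value of `Z`. -/
lemma tensorialAt_leibDeriv (D : Connection n M) {p : ℕ} {w : ℝ} {T : WTensor n M p w}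
    (hT : T.IsSmooth) {x y : M} (h : y ∈ (chartAt (EuclideanSpace ℝ (Fin n)) x).source)
    {X : Fin p → ∀ y : M, Tan n y}
    (hX : ∀ a, MDifferentiableAt (𝓡 n) ((𝓡 n).prod 𝓘(ℝ, EuclideanSpace ℝ (Fin n)))
      (fun y => (⟨y, X a y⟩ : TangentBundle (𝓡 n) M)) y) (u : Tan n y) (a : Fin p) :
    TensorialAt (𝓡 n) (EuclideanSpace ℝ (Fin n))
      (fun Z : ∀ y : M, TangentSpace (𝓡 n) y =>
        leibDeriv D T (coordFrame x) (Function.update X a Z) y u) y := by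
  have hev {Z : ∀ y : M, Tan n y} (hZ : MDifferentiableAt (𝓡 n)
      ((𝓡 n).prod 𝓘(ℝ, EuclideanSpace ℝ (Fin n)))
      (fun y => (⟨y, Z y⟩ : TangentBundle (𝓡 n) M)) y) :
      MDifferentiableAt (𝓡 n) 𝓘(ℝ, ℝ) (fun z => (T z).1 (coordFrame x z)
        (Function.update (fun b => X b z) a (Z z))) y := by
    have := mdifferentiableAt_eval hT h (X := Function.update X a Z) (fun b => by
      by_cases hb : b = a
      · subst hb; simpa using hZ
      · simpa [hb] using hX b)
    convert this using 4 with z b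
    by_cases hb : b = a
    · subst hb; simp
    · simp [hb]
  constructor
  · intro f Z hf hZ
    have hD := D.isCovariantDerivativeOnUniv.leibniz hZ hf
    rw [leibDeriv_update, leibDeriv_update]
    simp only [Pi.smul_apply', MultilinearMap.map_update_smul, smul_eq_mul]
    rw [mvfderiv_fun_mul hf (hev hZ), hD]
    simp only [MultilinearMap.map_update_add, add_apply, smul_apply, 
      MultilinearMap.map_update_smul, ContinuousLinearMap.smulRight_apply, smul_eq_mul,
      ← Finset.mul_sum]
    ring
  · intro Z Z' hZ hZ'
    have hD := D.isCovariantDerivativeOnUniv.add hZ hZ'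
    simp only [leibDeriv_update]
    simp only [Pi.add_apply, MultilinearMap.map_update_add]
    rw [mvfderiv_fun_add (hev hZ) (hev hZ'), hD]
    simp only [MultilinearMap.map_update_add, add_apply, Finset.sum_add_distrib]
    ring

lemma leibDeriv_congr (D : Connection n M) {p : ℕ} {w : ℝ} {T : WTensor n M p w}
    (hT : T.IsSmooth) {x y : M} (h : y ∈ (chartAt (EuclideanSpace ℝ (Fin n)) x).source)
    {X Y : Fin p → ∀ y : M, Tan n y}
    (hX : ∀ a, MDifferentiableAt (𝓡 n) ((𝓡 n).prod 𝓘(ℝ, EuclideanSpace ℝ (Fin n)))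
      (fun y => (⟨y, X a y⟩ : TangentBundle (𝓡 n) M)) y)
    (hY : ∀ a, MDifferentiableAt (𝓡 n) ((𝓡 n).prod 𝓘(ℝ, EuclideanSpace ℝ (Fin n)))
      (fun y => (⟨y, Y a y⟩ : TangentBundle (𝓡 n) M)) y)
    (hXY : ∀ a, X a y = Y a y) (u : Tan n y) :
    leibDeriv D T (coordFrame x) X y u = leibDeriv D T (coordFrame x) Y y u := by
  classical
  -- Tensoriality concerns one slot at a time, so the fields `X` are exchanged for `Y` slot by slot
  -- along a growing set `s`.
  have key : ∀ s : Finset (Fin p), leibDeriv D T (coordFrame x) (s.piecewise Y X) y u =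
      leibDeriv D T (coordFrame x) X y u := by
    intro s
    induction s using Finset.induction_on with
    | empty => simp
    | insert a s ha ih =>
      have hP : ∀ b, MDifferentiableAt (𝓡 n) ((𝓡 n).prod 𝓘(ℝ, EuclideanSpace ℝ (Fin n)))
          (fun y => (⟨y, s.piecewise Y X b y⟩ : TangentBundle (𝓡 n) M)) y := by
        intro b
        by_cases hb : b ∈ s
        · simpa [hb] using hY b
        · simpa [hb] using hX b
      rw [← ih, Finset.piecewise_insert]
      have := (tensorialAt_leibDeriv D hT h hP u a).pointwise (hY a) (hP a) (by simp [ha, hXY])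
      simpa using this
  have := key Finset.univ
  rwa [Finset.piecewise_univ, eq_comm] at this

end Leibniz

/-! ### Change of coordinate frame: Jacobi's formula, and `D T` in an arbitrary chart -/

section FrameChange

variable {n : ℕ} {M : Type*} [TopologicalSpace M] [ChartedSpace (EuclideanSpace ℝ (Fin n)) M]

lemma mvfderiv_finset_sum {ι : Type*} {s : Finset ι} {f : ι → M → ℝ} {y : M}
    (h : ∀ i ∈ s, MDifferentiableAt (𝓡 n) 𝓘(ℝ, ℝ) (f i) y) (u : Tan n y) :
    mvfderiv (𝓡 n) (fun z => ∑ i ∈ s, f i z) y u = ∑ i ∈ s, mvfderiv (𝓡 n) (f i) y u := by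
  classical
  induction s using Finset.induction_on with
  | empty => simp [mvfderiv_const]
  | insert a s ha ih =>
    simp only [Finset.sum_insert ha]
    rw [mvfderiv_fun_add (h a (by simp))
      (mdifferentiableAt_finset_sum fun i hi => h i (by simp [hi])), add_apply,
      ih fun i hi => h i (by simp [hi])]

lemma mvfderiv_finset_prod {ι : Type} [DecidableEq ι] {s : Finset ι} {f : ι → M → ℝ} {y : M}
    (h : ∀ i ∈ s, MDifferentiableAt (𝓡 n) 𝓘(ℝ, ℝ) (f i) y) (u : Tan n y) :
    mvfderiv (𝓡 n) (fun z => ∏ i ∈ s, f i z) y u =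
      ∑ i ∈ s, (∏ j ∈ s.erase i, f j y) * mvfderiv (𝓡 n) (f i) y u := by
  have key := (HasMFDerivAt.prod (t := s) (f := f) (z := y)
    (f' := fun i => (by exact mfderiv (𝓡 n) 𝓘(ℝ, ℝ) (f i) y)) fun i hi => (h i hi).hasMFDerivAt).mfderiv
  have hf : (fun z => ∏ i ∈ s, f i z) = ∏ i ∈ s, f i := by ext; simp
  rw [hf]
  have := congr($key u)
  exact this.trans (sum_apply _ _ _)

/-- The derivative of a determinant. -/
lemma mvfderiv_det {m : ℕ} {A : M → Matrix (Fin m) (Fin m) ℝ} {y : M}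
    (hA : ∀ i j, MDifferentiableAt (𝓡 n) 𝓘(ℝ, ℝ) (fun z => A z i j) y) (u : Tan n y) :
    mvfderiv (𝓡 n) (fun z => (A z).det) y u =
      ∑ j, ((A y).updateCol j fun i => mvfderiv (𝓡 n) (fun z => A z i j) y u).det := by
  simp only [Matrix.det_apply']
  rw [mvfderiv_finset_sum (f := fun (σ : Equiv.Perm (Fin m)) z =>
      ((Equiv.Perm.sign σ : ℤ) : ℝ) * ∏ i, A z (σ i) i)
    fun σ _ => mdifferentiableAt_const.mul
      (mdifferentiableAt_finset_prod (f := fun i z => A z (σ i) i) fun i _ => hA _ _),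
    Finset.sum_comm]
  refine Finset.sum_congr rfl fun σ _ => ?_
  rw [mvfderiv_fun_mul mdifferentiableAt_const
    (mdifferentiableAt_finset_prod (f := fun i z => A z (σ i) i) fun i _ => hA _ _),
    mvfderiv_const]
  simp only [smul_zero, add_zero, smul_apply, smul_eq_mul]
  rw [mvfderiv_finset_prod (f := fun i z => A z (σ i) i) fun i _ => hA _ _, Finset.mul_sum]
  refine Finset.sum_congr rfl fun j _ => ?_
  -- In the determinant with column `j` replaced, the factor of index `j` is the differentiated
  -- entry; the other factors are unchanged.
  rw [← Finset.mul_prod_erase _ _ (Finset.mem_univ j), Matrix.updateCol_self, mul_comm (∏ i ∈ _, _)]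
  congr 2
  refine Finset.prod_congr rfl fun i hi => ?_
  rw [Matrix.updateCol_ne (Finset.ne_of_mem_erase hi)]

lemma mvfderiv_comp_real {f : M → ℝ} {y : M} {φ : ℝ → ℝ} {φ' : ℝ} (hφ : HasDerivAt φ φ' (f y))
    (hf : MDifferentiableAt (𝓡 n) 𝓘(ℝ, ℝ) f y) (u : Tan n y) :
    MDifferentiableAt (𝓡 n) 𝓘(ℝ, ℝ) (fun z => φ (f z)) y ∧
      mvfderiv (𝓡 n) (fun z => φ (f z)) y u = φ' * mvfderiv (𝓡 n) f y u := by
  have h := HasMFDerivAt.comp y hφ.hasFDerivAt.hasMFDerivAt hf.hasMFDerivAt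
  refine ⟨h.mdifferentiableAt, ?_⟩
  have := congr($h.mfderiv u)
  refine this.trans ?_
  rw [mul_comm]
  rfl

/-- Cramer's rule: both sides are linear in `v`, and on the basis `F'` the left side vanishes for a
repeated vector. -/
lemma det_update_frame {x : M} (F F' : Frame n x) (j : Fin n) (v : Tan n x) :
    F.det (Function.update F' j v) = F.det F' * F'.coord j v := by
  have : F.det.toMultilinearMap.toLinearMap F' j = F.det F' • F'.coord j := by
    refine F'.ext fun k => ?_
    by_cases hjk : j = k
    · subst hjk; simp
    · rw [MultilinearMap.toLinearMap_apply]
      have := F.det.map_eq_zero_of_eq (Function.update F' j (F' k)) (i := j) (j := k)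
        (by rw [Function.update_self, Function.update_of_ne (Ne.symm hjk)]) hjk
      refine Eq.trans this ?_
      simp [Ne.symm hjk]
  exact congr($this v)

/-- Both sums are the trace of `L`. -/
lemma sum_coord_eq {x : M} (F F' : Frame n x) (L : Tan n x →ₗ[ℝ] Tan n x) :
    ∑ j, F'.coord j (L (F' j)) = ∑ j, F.coord j (L (F j)) := by
  have h (F : Frame n x) : ∑ j, F.coord j (L (F j)) = LinearMap.trace ℝ _ L := by
    rw [LinearMap.trace_eq_matrix_trace ℝ F, Matrix.trace]
    simp [LinearMap.toMatrix_apply]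
  rw [h, h]

variable [IsManifold (𝓡 n) ∞ M]

lemma connection_sum (D : Connection n M) {y : M} {ι : Type*} (s : Finset ι) {g : ι → M → ℝ}
    {Z : ι → ∀ y : M, Tan n y}
    (hg : ∀ i, MDifferentiableAt (𝓡 n) 𝓘(ℝ, ℝ) (g i) y)
    (hZ : ∀ i, MDifferentiableAt (𝓡 n) ((𝓡 n).prod 𝓘(ℝ, EuclideanSpace ℝ (Fin n)))
      (fun y => (⟨y, Z i y⟩ : TangentBundle (𝓡 n) M)) y) (u : Tan n y) :
    D (fun z => ∑ i ∈ s, g i z • Z i z) y u =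
      ∑ i ∈ s, (g i y • D (Z i) y u + mvfderiv (𝓡 n) (g i) y u • Z i y) := by
  classical
  have hgZ (i) : MDifferentiableAt (𝓡 n) ((𝓡 n).prod 𝓘(ℝ, EuclideanSpace ℝ (Fin n)))
      (fun y => (⟨y, g i y • Z i y⟩ : TangentBundle (𝓡 n) M)) y :=
    MDifferentiableAt.smul_section (hg i) (hZ i)
  induction s using Finset.induction_on with
  | empty =>
    exact congr($(D.zero) y u)
  | insert a s ha ih =>
    simp only [Finset.sum_insert ha]
    have h1 := D.isCovariantDerivativeOnUniv.add (σ := fun z => g a z • Z a z)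
      (σ' := fun z => ∑ i ∈ s, g i z • Z i z) (x := y) (hgZ a)
      (MDifferentiableAt.sum_section fun i _ => hgZ i)
    have h2 := D.isCovariantDerivativeOnUniv.leibniz (hZ a) (hg a)
    rw [← ih]
    refine congr($h1 u).trans ?_
    rw [add_apply]
    congr 1
    exact congr($h2 u)

lemma connection_congr (D : Connection n M) {y : M} {Z Z' : ∀ y : M, Tan n y}
    (hZ : MDifferentiableAt (𝓡 n) ((𝓡 n).prod 𝓘(ℝ, EuclideanSpace ℝ (Fin n)))
      (fun y => (⟨y, Z y⟩ : TangentBundle (𝓡 n) M)) y) (h : ∀ᶠ z in 𝓝 y, Z z = Z' z) :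
    D Z y = D Z' y := by
  refine D.isCovariantDerivativeOnUniv.congr_of_eventuallyEq hZ ?_ Filter.univ_mem h
  exact hZ.congr_of_eventuallyEq (h.mono fun z hz => by dsimp only; rw [hz])

lemma mdifferentiableAt_det {x x' y : M}
    (h : y ∈ (chartAt (EuclideanSpace ℝ (Fin n)) x).source)
    (h' : y ∈ (chartAt (EuclideanSpace ℝ (Fin n)) x').source) :
    MDifferentiableAt (𝓡 n) 𝓘(ℝ, ℝ) (fun z => (coordFrame (n := n) x z).det (coordFrame x' z)) y := by
  simp only [Module.Basis.det_apply, Matrix.det_apply']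
  exact mdifferentiableAt_finset_sum fun σ _ => mdifferentiableAt_const.mul
    (mdifferentiableAt_finset_prod fun i _ => mdifferentiableAt_coordFrame_coord h _
      (mdifferentiableAt_coordFrame h' i))

/-- Jacobi's formula for the transition determinant between two coordinate frames. -/
lemma mvfderiv_det_frame (D : Connection n M) {x x' y : M}
    (h : y ∈ (chartAt (EuclideanSpace ℝ (Fin n)) x).source)
    (h' : y ∈ (chartAt (EuclideanSpace ℝ (Fin n)) x').source) (u : Tan n y) :
    mvfderiv (𝓡 n) (fun z => (coordFrame (n := n) x z).det (coordFrame x' z)) y u =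
      (coordFrame (n := n) x y).det (coordFrame x' y) *
        ((∑ k, (coordFrame x' y).coord k (D (fun z => coordFrame x' z k) y u)) -
          ∑ k, (coordFrame x y).coord k (D (fun z => coordFrame x z k) y u)) := by
  have hA (i j : Fin n) : MDifferentiableAt (𝓡 n) 𝓘(ℝ, ℝ)
      (fun z => (coordFrame (n := n) x z).toMatrix (coordFrame x' z) i j) y :=
    mdifferentiableAt_coordFrame_coord h i (mdifferentiableAt_coordFrame h' j)
  -- Write the frame at `x'` as the frame at `x` times a transition matrix `A`. The Leibniz rule
  -- splits the derivative of its `j`-th vector into a part `v j` containing `dA` and a part in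
  -- which `A` is not differentiated.
  let v (j : Fin n) : Tan n y := ∑ i : Fin n, mvfderiv (𝓡 n)
    (fun z => (coordFrame (n := n) x z).toMatrix (coordFrame x' z) i j) y u • coordFrame x y i
  -- The undifferentiated part is one linear map applied to each frame vector. Its trace is
  -- therefore the same in both frames, and the difference of the two connection traces is the
  -- contribution of `v` alone.
  let L : Tan n y →ₗ[ℝ] Tan n y :=
    ∑ i, ((coordFrame x y).coord i).smulRight (D (fun z => coordFrame x z i) y u)
  have hD (j : Fin n) : D (fun z => coordFrame x' z j) y u = L (coordFrame x' y j) + v j := by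
    rw [show (fun z => coordFrame (n := n) x' z j) = fun z =>
      ∑ i, (coordFrame (n := n) x z).toMatrix (coordFrame x' z) i j • coordFrame x z i from
      funext fun z => ((coordFrame x z).sum_toMatrix_smul_self (coordFrame x' z) j).symm,
      connection_sum D _ (fun i => hA i j) fun i => mdifferentiableAt_coordFrame h i,
      Finset.sum_add_distrib]
    congr 1
    simp only [L, LinearMap.sum_apply, LinearMap.smulRight_apply]
    rfl
  have hL : ∑ k, (coordFrame (n := n) x' y).coord k (L (coordFrame x' y k)) =
      ∑ k, (coordFrame x y).coord k (D (fun z => coordFrame x z k) y u) := by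
    rw [sum_coord_eq (coordFrame x y)]
    refine Finset.sum_congr rfl fun k _ => ?_
    congr 1
    simp [L, Finsupp.single_apply]
  simp only [Module.Basis.det_apply]
  rw [mvfderiv_det hA]
  simp only [hD, map_add, Finset.sum_add_distrib, hL]
  rw [add_sub_cancel_left, Finset.mul_sum]
  refine Finset.sum_congr rfl fun j _ => ?_
  rw [← Module.Basis.det_apply, ← det_update_frame, Module.Basis.det_apply,
    Module.Basis.toMatrix_update]
  congr 2
  funext i
  simp [v, Finsupp.single_apply]

lemma hasDerivAt_abs_rpow (q : ℝ) {d : ℝ} (hd : d ≠ 0) :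
    HasDerivAt (fun t : ℝ => |t| ^ q) (q * |d| ^ q * d⁻¹) d := by
  convert! (hasDerivAt_abs hd).rpow_const (p := q) (.inl (abs_ne_zero.mpr hd)) using 1
  rw [Real.rpow_sub_one (abs_ne_zero.mpr hd)]
  rcases lt_or_gt_of_ne hd with hd' | hd'
  · simp only [hd', abs_of_neg, sign_neg]
    simp
    field_simp
  · simp only [hd', abs_of_pos, sign_pos]
    simp
    field_simp

/-- The derivative of the transition factor `|det|^{-w/n}` contributes `-w/n` times the difference
of the connection traces in the two frames. This is exactly the change in the density term of
`leibDeriv`. -/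
lemma leibDeriv_frame (D : Connection n M) {p : ℕ} {w : ℝ} {T : WTensor n M p w}
    (hT : T.IsSmooth) {x x' y : M} (h : y ∈ (chartAt (EuclideanSpace ℝ (Fin n)) x).source)
    (h' : y ∈ (chartAt (EuclideanSpace ℝ (Fin n)) x').source)
    {X : Fin p → ∀ y : M, Tan n y}
    (hX : ∀ a, MDifferentiableAt (𝓡 n) ((𝓡 n).prod 𝓘(ℝ, EuclideanSpace ℝ (Fin n)))
      (fun y => (⟨y, X a y⟩ : TangentBundle (𝓡 n) M)) y) (u : Tan n y) :
    leibDeriv D T (coordFrame x') X y u =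
      |(coordFrame (n := n) x y).det (coordFrame x' y)| ^ (-w / n) *
        leibDeriv D T (coordFrame x) X y u := by
  have hd : (coordFrame (n := n) x y).det (coordFrame x' y) ≠ 0 := Twisted.det_ne_zero _ _
  have hφ := hasDerivAt_abs_rpow (-w / n) hd
  obtain ⟨h1, h2⟩ := mvfderiv_comp_real
    (f := fun z => (coordFrame (n := n) x z).det (coordFrame x' z)) (y := y) hφ
    (mdifferentiableAt_det h h') u
  rw [mvfderiv_det_frame D h h' u] at h2
  have h3 : (fun z => (T z).1 (coordFrame (n := n) x' z) fun a => X a z) = fun z =>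
      |(coordFrame (n := n) x z).det (coordFrame x' z)| ^ (-w / n) *
        (T z).1 (coordFrame x z) fun a => X a z := by
    funext z
    rw [(T z).2 (coordFrame x z) (coordFrame x' z)]
    rfl
  unfold leibDeriv
  rw [h3, mvfderiv_fun_mul h1 (mdifferentiableAt_eval hT h hX),
    (T y).2 (coordFrame x y) (coordFrame x' y)]
  simp only [add_apply, smul_apply, smul_eq_mul, h2,
    ← Finset.mul_sum]
  rw [mul_assoc (_ * _) _⁻¹, inv_mul_cancel_left₀ hd]
  ring

/-- `leibDeriv` as a linear function of the direction. -/
def leibDerivLinear (D : Connection n M) {p : ℕ} {w : ℝ} (T : WTensor n M p w)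
    (F : ∀ y : M, Frame n y) (X : Fin p → ∀ y : M, Tan n y) (y : M) : Tan n y →ₗ[ℝ] ℝ where
  toFun u := leibDeriv D T F X y u
  map_add' u v := by
    simp only [leibDeriv, map_add, MultilinearMap.map_update_add, Finset.sum_add_distrib]
    ring
  map_smul' r u := by
    simp only [leibDeriv, map_smul, MultilinearMap.map_update_smul, smul_eq_mul,
      ← Finset.mul_sum, RingHom.id_apply]
    ring

/-- The vector field with constant components in the preferred chart at `y` and the value `v`
at `y`. -/
def constField (y : M) (v : Tan n y) (z : M) : Tan n z :=
  ∑ k, (coordFrame y y).coord k v • coordFrame y z k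

lemma mdifferentiableAt_constField (y : M) (v : Tan n y) :
    MDifferentiableAt (𝓡 n) ((𝓡 n).prod 𝓘(ℝ, EuclideanSpace ℝ (Fin n)))
      (fun z => (⟨z, constField y v z⟩ : TangentBundle (𝓡 n) M)) y :=
  MDifferentiableAt.sum_section fun i _ => MDifferentiableAt.smul_section
    (f := fun _ => (coordFrame y y).coord i v) mdifferentiableAt_const
    (mdifferentiableAt_coordFrame (mem_chart_source _ y) i)

lemma constField_self (y : M) (v : Tan n y) : constField y v y = v := by
  simp [constField]

/-- `leibDeriv` as a multilinear function of the values of the vector fields. -/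
def leibDerivMulti (D : Connection n M) {p : ℕ} {w : ℝ} {T : WTensor n M p w}
    (hT : T.IsSmooth) (y : M) (u : Tan n y) : Multi n y p where
  toFun v := leibDeriv D T (coordFrame y) (fun a => constField y (v a)) y u
  map_update_add' {dec} v a s t := by
    -- `MultilinearMap` quantifies over every decidability instance on the index type, and this
    -- fixes the one used by `leibDeriv`.
    obtain rfl : dec = instDecidableEqFin p := Subsingleton.elim _ _
    have key (s : Tan n y) : (fun b => constField y (Function.update v a s b)) =
        Function.update (fun b => constField y (v b)) a (constField y s) := by
      funext b
      by_cases hb : b = a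
      · subst hb; simp
      · simp [hb]
    rw [key, key, key]
    rw [← (tensorialAt_leibDeriv D hT (mem_chart_source _ y)
      (fun b => mdifferentiableAt_constField y (v b)) u a).add
      (mdifferentiableAt_constField y s) (mdifferentiableAt_constField y t)]
    congr 2
    funext z
    simp [constField, add_smul, Finset.sum_add_distrib]
  map_update_smul' {dec} v a r s := by
    obtain rfl : dec = instDecidableEqFin p := Subsingleton.elim _ _
    have key (s : Tan n y) : (fun b => constField y (Function.update v a s b)) =
        Function.update (fun b => constField y (v b)) a (constField y s) := by
      funext b
      by_cases hb : b = a
      · subst hb; simp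
      · simp [hb]
    rw [key, key]
    have := (tensorialAt_leibDeriv D hT (mem_chart_source _ y)
      (fun b => mdifferentiableAt_constField y (v b)) u a).smul
      (f := fun _ => r) mdifferentiableAt_const (mdifferentiableAt_constField y s)
    refine Eq.trans ?_ this
    congr 2
    funext z
    simp [constField, mul_smul, Finset.smul_sum]

lemma covDeriv_apply (D : Connection n M) {p : ℕ} {w : ℝ} (T : WTensor n M p w) (y : M)
    (u : Tan n y) (v : Fin p → Tan n y) :
    (covDeriv D T y).1 (coordFrame y y) (Fin.cons u v) =
      ∑ i, ∑ J : Fin p → Fin n, (coordFrame y y).coord i u *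
        ((∏ a, (coordFrame y y).coord (J a) (v a)) * derivComp D T y i J) := by
  change ((|(coordFrame y y).det (coordFrame y y)| ^ (-w / n) • ∑ J : Fin (p + 1) → Fin n,
    derivComp D T y (J 0) (Fin.tail J) • dualTensor (coordFrame y y) J : Multi n y (p + 1)))
      (Fin.cons u v) = _
  rw [Module.Basis.det_self, abs_one, Real.one_rpow, one_smul, sum_apply,
    ← (Fin.consEquiv fun _ => Fin n).sum_comp, Fintype.sum_prod_type]
  refine Finset.sum_congr rfl fun i _ => Finset.sum_congr rfl fun J _ => ?_
  simp [dualTensor, Fin.consEquiv, Fin.prod_univ_succ]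
  ring

/-- By `leibDeriv_congr` the fields may be replaced by ones with constant coefficients in the chart.
Multilinearity then reduces the claim to coordinate fields, where `leibDeriv` is `derivComp` by
definition. -/
lemma leibDeriv_eq_covDeriv (D : Connection n M) {p : ℕ} {w : ℝ} {T : WTensor n M p w}
    (hT : T.IsSmooth) {y : M} {X : Fin p → ∀ y : M, Tan n y}
    (hX : ∀ a, MDifferentiableAt (𝓡 n) ((𝓡 n).prod 𝓘(ℝ, EuclideanSpace ℝ (Fin n)))
      (fun y => (⟨y, X a y⟩ : TangentBundle (𝓡 n) M)) y) (u : Tan n y) :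
    leibDeriv D T (coordFrame y) X y u =
      (covDeriv D T y).1 (coordFrame y y) (Fin.cons u fun a => X a y) := by
  have h1 (u : Tan n y) : leibDeriv D T (coordFrame y) X y u =
      ∑ J : Fin p → Fin n, (∏ a, (coordFrame y y).coord (J a) (X a y)) *
        leibDeriv D T (coordFrame y) (fun a z => coordFrame y z (J a)) y u := by
    rw [leibDeriv_congr D hT (mem_chart_source _ y) hX
      (fun a => mdifferentiableAt_constField y (X a y)) (fun a => (constField_self y _).symm) u]
    refine (multi_expand (coordFrame y y) (leibDerivMulti D hT y u) fun a => X a y).trans ?_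
    refine Finset.sum_congr rfl fun J _ => congrArg _ ?_
    exact leibDeriv_congr D hT (mem_chart_source _ y)
      (fun a => mdifferentiableAt_constField y _)
      (fun a => mdifferentiableAt_coordFrame (mem_chart_source _ y) (J a))
      (fun a => constField_self y _) u
  have h2 (u : Tan n y) (J : Fin p → Fin n) :
      leibDeriv D T (coordFrame y) (fun a z => coordFrame y z (J a)) y u =
        ∑ i, (coordFrame y y).coord i u * derivComp D T y i J := by
    conv_lhs => rw [← (coordFrame y y).sum_repr u]
    refine (map_sum (leibDerivLinear D T (coordFrame y) _ y) _ _).trans ?_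
    refine Finset.sum_congr rfl fun i _ => ?_
    rw [map_smul]
    rfl
  rw [covDeriv_apply, h1, Finset.sum_comm]
  refine Finset.sum_congr rfl fun J _ => ?_
  rw [h2, Finset.mul_sum]
  refine Finset.sum_congr rfl fun i _ => ?_
  ring

/-- The components of `D T` can be computed in every chart. -/
lemma coordComp_covDeriv (D : Connection n M) {p : ℕ} {w : ℝ} {T : WTensor n M p w}
    (hT : T.IsSmooth) {x y : M} (h : y ∈ (chartAt (EuclideanSpace ℝ (Fin n)) x).source)
    (J : Fin (p + 1) → Fin n) :
    coordComp (covDeriv D T) x J y =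
      leibDeriv D T (coordFrame x) (fun a z => coordFrame x z (J a.succ)) y
        (coordFrame x y (J 0)) := by
  have hX (a : Fin p) := mdifferentiableAt_coordFrame h (J a.succ)
  rw [leibDeriv_frame D hT (mem_chart_source _ y) h hX, leibDeriv_eq_covDeriv D hT hX,
    coordComp, (covDeriv D T y).2 (coordFrame y y) (coordFrame x y), smul_apply, smul_eq_mul]
  congr 2
  funext a
  refine Fin.cases ?_ (fun a => ?_) a <;> simp

end FrameChange

/-! ### Tensor calculus with Christoffel symbols on a normed space -/

section LocalCalculus

open Matrix

variable {n : ℕ} {E : Type*} [NormedAddCommGroup E] [NormedSpace ℝ E]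

/-- The derivative of `f` in the direction `e i`. -/
def pd (e : Fin n → E) (i : Fin n) (f : E → ℝ) (z : E) : ℝ :=
  fderiv ℝ f z (e i)

variable (e : Fin n → E) {z : E}

lemma pd_add {f g : E → ℝ} (hf : DifferentiableAt ℝ f z) (hg : DifferentiableAt ℝ g z)
    (k : Fin n) : pd e k (fun z => f z + g z) z = pd e k f z + pd e k g z := by
  simp [pd, fderiv_fun_add hf hg]

lemma pd_sub {f g : E → ℝ} (hf : DifferentiableAt ℝ f z) (hg : DifferentiableAt ℝ g z)
    (k : Fin n) : pd e k (fun z => f z - g z) z = pd e k f z - pd e k g z := by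
  simp [pd, fderiv_fun_sub hf hg]

lemma pd_neg {f : E → ℝ} (k : Fin n) : pd e k (fun z => -f z) z = -pd e k f z := by
  simp [pd, fderiv_fun_neg]

lemma pd_mul {f g : E → ℝ} (hf : DifferentiableAt ℝ f z) (hg : DifferentiableAt ℝ g z)
    (k : Fin n) : pd e k (fun z => f z * g z) z = pd e k f z * g z + f z * pd e k g z := by
  simp [pd, fderiv_fun_mul hf hg]
  ring

lemma pd_const_mul {f : E → ℝ} (hf : DifferentiableAt ℝ f z) (r : ℝ) (k : Fin n) :
    pd e k (fun z => r * f z) z = r * pd e k f z := by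
  simp [pd, fderiv_const_mul hf]

lemma pd_sum {ι : Type*} {s : Finset ι} {f : ι → E → ℝ} (hf : ∀ i, DifferentiableAt ℝ (f i) z)
    (k : Fin n) : pd e k (fun z => ∑ i ∈ s, f i z) z = ∑ i ∈ s, pd e k (f i) z := by
  simp [pd, fderiv_fun_sum fun i _ => hf i]

lemma pd_comm {f : E → ℝ} (hf : ContDiffAt ℝ 2 f z) (i j : Fin n) :
    pd e i (pd e j f) z = pd e j (pd e i f) z := by
  have hd : DifferentiableAt ℝ (fderiv ℝ f) z :=
    (hf.fderiv_right (m := 1) (by norm_num)).differentiableAt (by norm_num)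
  have h (i j : Fin n) : pd e i (pd e j f) z = fderiv ℝ (fderiv ℝ f) z (e i) (e j) := by
    unfold pd
    rw [fderiv_clm_apply hd (differentiableAt_const _)]
    simp
  rw [h, h]
  exact (hf.isSymmSndFDerivAt (by simp)).eq _ _

lemma differentiableAt_pd {f : E → ℝ} (hf : ContDiffAt ℝ 2 f z) (i : Fin n) :
    DifferentiableAt ℝ (pd e i f) z := by
  have hd : DifferentiableAt ℝ (fderiv ℝ f) z :=
    (hf.fderiv_right (m := 1) (by norm_num)).differentiableAt (by norm_num)
  exact hd.clm_apply (differentiableAt_const _)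

/-- The trace `∑ Γ_{im}^m` of the Christoffel symbols. -/
def traceSymbol (Γ : Fin n → Fin n → Fin n → E → ℝ) (i : Fin n) (z : E) : ℝ :=
  ∑ m, Γ i m m z

/-- The components of the curvature tensor, `R_{∂_k, ∂_i} ∂_j = ∑ R_{kij}^m ∂_m`. -/
def curvSymbol (Γ : Fin n → Fin n → Fin n → E → ℝ) (k i j m : Fin n) (z : E) : ℝ :=
  pd e k (Γ i j m) z - pd e i (Γ k j m) z + ∑ l, (Γ i j l z * Γ k l m z - Γ k j l z * Γ i l m z)

/-- The curvature of the bundle of densities of weight `n`. -/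
def traceCurv (Γ : Fin n → Fin n → Fin n → E → ℝ) (k i : Fin n) (z : E) : ℝ :=
  ∑ m, curvSymbol e Γ k i m m z

/-- The covariant derivative of a density. -/
def covZero (s : ℝ) (Γ : Fin n → Fin n → Fin n → E → ℝ) (a : E → ℝ) (i : Fin n) (z : E) : ℝ :=
  pd e i a z + s * traceSymbol Γ i z * a z

/-- The covariant derivative of a weighted `1`-tensor. -/
def covOne (s : ℝ) (Γ : Fin n → Fin n → Fin n → E → ℝ) (a : Fin n → E → ℝ) (i j : Fin n)
    (z : E) : ℝ :=
  pd e i (a j) z - ∑ m, Γ i j m z * a m z + s * traceSymbol Γ i z * a j z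

/-- The covariant derivative of a weighted `2`-tensor. -/
def covTwo (s : ℝ) (Γ : Fin n → Fin n → Fin n → E → ℝ) (b : Fin n → Fin n → E → ℝ)
    (k i j : Fin n) (z : E) : ℝ :=
  pd e k (b i j) z - (∑ m, Γ k i m z * b m j z + ∑ m, Γ k j m z * b i m z)
    + s * traceSymbol Γ k z * b i j z

variable {Γ : Fin n → Fin n → Fin n → E → ℝ}

lemma differentiableAt_traceSymbol (hΓ : ∀ i j m, DifferentiableAt ℝ (Γ i j m) z) (i : Fin n) :
    DifferentiableAt ℝ (traceSymbol Γ i) z :=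
  DifferentiableAt.fun_sum fun m _ => hΓ i m m

/-- The quadratic terms of the curvature cancel in the trace after exchanging the two summation
indices. -/
lemma traceCurv_eq (hΓ : ∀ i j m, DifferentiableAt ℝ (Γ i j m) z) (k i : Fin n) :
    traceCurv e Γ k i z = pd e k (traceSymbol Γ i) z - pd e i (traceSymbol Γ k) z := by
  unfold traceCurv curvSymbol traceSymbol
  rw [pd_sum e (fun m => hΓ i m m), pd_sum e (fun m => hΓ k m m)]
  simp only [Finset.sum_add_distrib, Finset.sum_sub_distrib]
  rw [Finset.sum_comm (f := fun m l => Γ k m l z * Γ i l m z)]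
  simp only [mul_comm (Γ k _ _ z), sub_self, add_zero]

lemma traceCurv_swap (k i : Fin n) : traceCurv e Γ k i z = -traceCurv e Γ i k z := by
  simp only [traceCurv, curvSymbol, ← Finset.sum_neg_distrib]
  refine Finset.sum_congr rfl fun m _ => ?_
  rw [neg_add, ← Finset.sum_neg_distrib]
  simp only [neg_sub]

lemma sum_mul_sum_comm (x y : Fin n → ℝ) (w : Fin n → Fin n → ℝ) :
    ∑ m, x m * ∑ l, w m l * y l = ∑ l, (∑ m, x m * w m l) * y l := by
  simp only [Finset.mul_sum, Finset.sum_mul]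
  rw [Finset.sum_comm]
  exact Finset.sum_congr rfl fun _ _ => Finset.sum_congr rfl fun _ _ => by ring

lemma differentiableAt_covOne {s : ℝ} {a : Fin n → E → ℝ} (ha : ∀ j, ContDiffAt ℝ 2 (a j) z)
    (hΓ : ∀ i j m, DifferentiableAt ℝ (Γ i j m) z) (i j : Fin n) :
    DifferentiableAt ℝ (covOne e s Γ a i j) z := by
  have ha' (j) : DifferentiableAt ℝ (a j) z := (ha j).differentiableAt (by norm_num)
  exact ((differentiableAt_pd e (ha j) i).sub (DifferentiableAt.fun_sum fun m _ =>
    (hΓ i j m).mul (ha' m))).add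
      (((differentiableAt_const _).mul (differentiableAt_traceSymbol hΓ i)).mul (ha' j))

lemma pd_covOne {s : ℝ} {a : Fin n → E → ℝ} (ha : ∀ j, ContDiffAt ℝ 2 (a j) z)
    (hΓ : ∀ i j m, DifferentiableAt ℝ (Γ i j m) z) (k j i : Fin n) :
    pd e k (covOne e s Γ a j i) z = pd e k (pd e j (a i)) z
      - ((∑ m, pd e k (Γ j i m) z * a m z) + ∑ m, Γ j i m z * pd e k (a m) z)
      + (s * pd e k (traceSymbol Γ j) z * a i z + s * traceSymbol Γ j z * pd e k (a i) z) := by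
  have ha' (j) : DifferentiableAt ℝ (a j) z := (ha j).differentiableAt (by norm_num)
  have hθ := differentiableAt_traceSymbol hΓ j
  unfold covOne
  rw [pd_add e ((differentiableAt_pd e (ha i) j).fun_sub (DifferentiableAt.fun_sum fun m _ =>
    (hΓ j i m).fun_mul (ha' m))) (((differentiableAt_const _).fun_mul hθ).fun_mul (ha' i)),
    pd_sub e (differentiableAt_pd e (ha i) j) (DifferentiableAt.fun_sum fun m _ =>
      (hΓ j i m).fun_mul (ha' m)),
    pd_sum e (fun m => (hΓ j i m).fun_mul (ha' m)),
    pd_mul e ((differentiableAt_const _).fun_mul hθ) (ha' i), pd_const_mul e hθ,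
    ← Finset.sum_add_distrib, Finset.sum_congr rfl fun m _ => pd_mul e (hΓ j i m) (ha' m) k]

/-- The Ricci identity for weighted `1`-forms. -/
lemma ricci_identity {s : ℝ} {a : Fin n → E → ℝ} (ha : ∀ j, ContDiffAt ℝ 2 (a j) z)
    (hΓ : ∀ i j m, DifferentiableAt ℝ (Γ i j m) z) (hsymm : ∀ i j m, Γ i j m z = Γ j i m z)
    (k j i : Fin n) :
    covTwo e s Γ (covOne e s Γ a) k j i z - covTwo e s Γ (covOne e s Γ a) j k i z =
      -(∑ m, curvSymbol e Γ k j i m z * a m z) + s * traceCurv e Γ k j z * a i z := by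
  unfold covTwo
  rw [pd_covOne e ha hΓ, pd_covOne e ha hΓ, pd_comm e (ha i) k j, traceCurv_eq e hΓ]
  -- Vanishing torsion makes the terms `∑ Γ_{kj}^m D_m α_i` of the two second derivatives equal, so
  -- that they cancel.
  simp only [hsymm j k]
  have h (k j : Fin n) : ∑ m, Γ k i m z * covOne e s Γ a j m z =
      ∑ m, Γ k i m z * pd e j (a m) z - ∑ l, (∑ m, Γ k i m z * Γ j m l z) * a l z
        + s * traceSymbol Γ j z * ∑ m, Γ k i m z * a m z := by
    rw [← sum_mul_sum_comm, Finset.mul_sum, ← Finset.sum_sub_distrib, ← Finset.sum_add_distrib]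
    refine Finset.sum_congr rfl fun m _ => ?_
    unfold covOne
    ring
  rw [h, h]
  have hc : ∑ m, curvSymbol e Γ k j i m z * a m z =
      ∑ m, pd e k (Γ j i m) z * a m z - ∑ m, pd e j (Γ k i m) z * a m z
        + (∑ l, (∑ m, Γ j i m z * Γ k m l z) * a l z
          - ∑ l, (∑ m, Γ k i m z * Γ j m l z) * a l z) := by
    rw [← Finset.sum_sub_distrib, ← Finset.sum_sub_distrib, ← Finset.sum_add_distrib]
    refine Finset.sum_congr rfl fun m _ => ?_
    rw [curvSymbol, Finset.sum_sub_distrib]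
    ring
  rw [hc]
  unfold covOne
  ring

/-- The curvature of a connection preserving a weighted symmetric `2`-tensor. -/
lemma curvSymbol_metric {r : ℝ} {g : Fin n → Fin n → E → ℝ}
    (hg : ∀ i j, ContDiffAt ℝ 2 (g i j) z) (hΓ : ∀ i j m, DifferentiableAt ℝ (Γ i j m) z)
    (hpar : ∀ᶠ y in 𝓝 z, ∀ k i j, covTwo e r Γ g k i j y = 0) (k j i p : Fin n) :
    ∑ m, curvSymbol e Γ k j i m z * g m p z + ∑ m, curvSymbol e Γ k j p m z * g i m z =
      r * traceCurv e Γ k j z * g i p z := by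
  have hg' (i j) : DifferentiableAt ℝ (g i j) z := (hg i j).differentiableAt (by norm_num)
  have h0 (k i j) : pd e k (g i j) z = (∑ m, Γ k i m z * g m j z + ∑ m, Γ k j m z * g i m z)
      - r * traceSymbol Γ k z * g i j z := by
    have := hpar.self_of_nhds k i j
    unfold covTwo at this
    linarith
  have h1 (k j : Fin n) : pd e k (pd e j (g i p)) z =
      ((∑ m, (pd e k (Γ j i m) z * g m p z + Γ j i m z * pd e k (g m p) z)) +
        ∑ m, (pd e k (Γ j p m) z * g i m z + Γ j p m z * pd e k (g i m) z))
      - (r * pd e k (traceSymbol Γ j) z * g i p z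
        + r * traceSymbol Γ j z * pd e k (g i p) z) := by
    have hθ := differentiableAt_traceSymbol hΓ j
    -- The parallel equation is about to be differentiated, so it has to hold near `z` and not only
    -- at `z`.
    have he : pd e j (g i p) =ᶠ[𝓝 z] fun y =>
        (∑ m, Γ j i m y * g m p y + ∑ m, Γ j p m y * g i m y)
          - r * traceSymbol Γ j y * g i p y := by
      filter_upwards [hpar] with y hy
      have := hy j i p
      unfold covTwo at this
      linarith
    have hs1 := fun m => (hΓ j i m).fun_mul (hg' m p)
    have hs2 := fun m => (hΓ j p m).fun_mul (hg' i m)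
    rw [pd, he.fderiv_eq, ← pd, pd_sub e ((DifferentiableAt.fun_sum fun m _ => hs1 m).fun_add
        (DifferentiableAt.fun_sum fun m _ => hs2 m))
        (((differentiableAt_const _).fun_mul hθ).fun_mul (hg' i p)),
      pd_add e (DifferentiableAt.fun_sum fun m _ => hs1 m)
        (DifferentiableAt.fun_sum fun m _ => hs2 m), pd_sum e hs1, pd_sum e hs2,
      pd_mul e ((differentiableAt_const _).fun_mul hθ) (hg' i p), pd_const_mul e hθ]
    congr 2
    · exact Finset.sum_congr rfl fun m _ => pd_mul e (hΓ j i m) (hg' m p) k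
    · exact Finset.sum_congr rfl fun m _ => pd_mul e (hΓ j p m) (hg' i m) k
  -- Equality of mixed partials of `g` is the integrability condition; what remains is to eliminate
  -- the first derivatives of `g` by the parallel equation.
  have h2 := (h1 k j).symm.trans ((pd_comm e (hg i p) k j).trans (h1 j k))
  have hL (k j : Fin n) : ∑ m, Γ j i m z * pd e k (g m p) z =
      (∑ l, (∑ m, Γ j i m z * Γ k m l z) * g l p z)
        + (∑ m, Γ j i m z * ∑ l, Γ k p l z * g m l z)
        - r * traceSymbol Γ k z * ∑ m, Γ j i m z * g m p z := by
    rw [← sum_mul_sum_comm, Finset.mul_sum, ← Finset.sum_add_distrib, ← Finset.sum_sub_distrib]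
    refine Finset.sum_congr rfl fun m _ => ?_
    rw [h0]
    ring
  have hR (k j : Fin n) : ∑ m, Γ j p m z * pd e k (g i m) z =
      (∑ m, Γ k i m z * ∑ l, Γ j p l z * g m l z)
        + (∑ l, (∑ m, Γ j p m z * Γ k m l z) * g i l z)
        - r * traceSymbol Γ k z * ∑ m, Γ j p m z * g i m z := by
    -- The mixed products `Γ_{ji}^m Γ_{kp}^l g_{ml}` in `hL k j` recur in `hR j k`. Put in the same
    -- shape, they cancel in the difference under `k ↔ j`.
    have hx : ∑ m, Γ k i m z * ∑ l, Γ j p l z * g m l z =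
        ∑ l, Γ j p l z * ∑ m, Γ k i m z * g m l z := by
      simp only [Finset.mul_sum]
      rw [Finset.sum_comm]
      exact Finset.sum_congr rfl fun _ _ => Finset.sum_congr rfl fun _ _ => by ring
    rw [hx, ← sum_mul_sum_comm _ fun l => g i l z, Finset.mul_sum, ← Finset.sum_add_distrib,
      ← Finset.sum_sub_distrib]
    refine Finset.sum_congr rfl fun m _ => ?_
    rw [h0]
    ring
  have hc (i : Fin n) (v : Fin n → ℝ) : ∑ m, curvSymbol e Γ k j i m z * v m =
      ∑ m, pd e k (Γ j i m) z * v m - ∑ m, pd e j (Γ k i m) z * v m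
        + (∑ l, (∑ m, Γ j i m z * Γ k m l z) * v l
          - ∑ l, (∑ m, Γ k i m z * Γ j m l z) * v l) := by
    rw [← Finset.sum_sub_distrib, ← Finset.sum_sub_distrib, ← Finset.sum_add_distrib]
    refine Finset.sum_congr rfl fun m _ => ?_
    rw [curvSymbol, Finset.sum_sub_distrib]
    ring
  rw [hc i fun m => g m p z, hc p fun m => g i m z, traceCurv_eq e hΓ]
  simp only [Finset.sum_add_distrib, hL, hR, h0 _ i p] at h2
  linear_combination h2

/-- The inverse of a parallel metric is parallel. -/
lemma pd_inverse_metric {r : ℝ} {g h : Fin n → Fin n → E → ℝ}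
    (hg : ∀ i j, DifferentiableAt ℝ (g i j) z) (hh : ∀ i j, DifferentiableAt ℝ (h i j) z)
    (hinv : ∀ᶠ y in 𝓝 z, ∀ i j, ∑ m, g i m y * h m j y = if i = j then 1 else 0)
    (hpar : ∀ k i j, covTwo e r Γ g k i j z = 0) (k i j : Fin n) :
    pd e k (h i j) z = -(∑ m, h i m z * Γ k m j z) - (∑ m, Γ k m i z * h m j z)
      + r * traceSymbol Γ k z * h i j z := by
  let G : Matrix (Fin n) (Fin n) ℝ := of fun i j => g i j z
  let H : Matrix (Fin n) (Fin n) ℝ := of fun i j => h i j z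
  let dG : Matrix (Fin n) (Fin n) ℝ := of fun i j => pd e k (g i j) z
  let dH : Matrix (Fin n) (Fin n) ℝ := of fun i j => pd e k (h i j) z
  let P : Matrix (Fin n) (Fin n) ℝ := of fun i m => Γ k i m z
  have h1 : G * H = 1 := by
    ext i j
    rw [mul_apply, one_apply]
    exact hinv.self_of_nhds i j
  have h2 : H * G = 1 := mul_eq_one_comm.mp h1
  have h3 : dG * H + G * dH = 0 := by
    ext i j
    have he : (fun y => ∑ m, g i m y * h m j y) =ᶠ[𝓝 z] fun _ => if i = j then 1 else 0 := by
      filter_upwards [hinv] with y hy using hy i j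
    have h0 : pd e k (fun y => ∑ m, g i m y * h m j y) z = 0 := by
      rw [pd, he.fderiv_eq]
      simp
    rw [pd_sum e (fun m => (hg i m).fun_mul (hh m j)),
      Finset.sum_congr rfl fun m _ => pd_mul e (hg i m) (hh m j) k, Finset.sum_add_distrib] at h0
    exact h0
  have h4 : dG = P * G + G * Pᵀ - (r * traceSymbol Γ k z) • G := by
    ext i j
    have := hpar k i j
    unfold covTwo at this
    simp only [dG, P, G, of_apply, Matrix.sub_apply, Matrix.add_apply, mul_apply, transpose_apply,
      Matrix.smul_apply,
      smul_eq_mul]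
    simp only [mul_comm (g i _ z)]
    linarith
  -- Differentiating `G H = 1` gives `dH = -H dG H`; the parallel equation `h4` is then inserted for
  -- `dG`.
  have h5 : dH = -(H * P) - Pᵀ * H + (r * traceSymbol Γ k z) • H := by
    calc dH = H * G * dH := by rw [h2, one_mul]
      _ = -(H * dG * H) := by
        rw [mul_assoc, eq_neg_of_add_eq_zero_right h3, mul_neg, mul_assoc]
      _ = -(H * P * (G * H)) - H * G * Pᵀ * H + (r * traceSymbol Γ k z) • (H * G * H) := by
        rw [h4]
        simp only [mul_sub, mul_add, sub_mul, add_mul, mul_smul_comm, smul_mul_assoc, mul_assoc]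
        abel
      _ = _ := by rw [h1, h2, mul_one, one_mul, one_mul]
  have := congr($h5 i j)
  simpa only [dH, H, P, of_apply, Matrix.sub_apply, Matrix.add_apply, Matrix.neg_apply, mul_apply,
    transpose_apply, Matrix.smul_apply, smul_eq_mul] using this

/-- Contraction with a parallel metric commutes with the covariant derivative. -/
lemma covZero_contract {r s : ℝ} {h b : Fin n → Fin n → E → ℝ}
    (hh : ∀ i j, DifferentiableAt ℝ (h i j) z) (hb : ∀ i j, DifferentiableAt ℝ (b i j) z)
    (k : Fin n)
    (hpar : ∀ i j, pd e k (h i j) z = -(∑ m, h i m z * Γ k m j z) - (∑ m, Γ k m i z * h m j z)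
      + r * traceSymbol Γ k z * h i j z) :
    covZero e (s - r) Γ (fun y => ∑ i, ∑ j, h i j y * b i j y) k z =
      ∑ i, ∑ j, h i j z * covTwo e s Γ b k i j z := by
  unfold covZero
  rw [pd_sum e (fun i => DifferentiableAt.fun_sum fun j _ => (hh i j).fun_mul (hb i j)),
    Finset.sum_congr rfl fun i _ => pd_sum e (fun j => (hh i j).fun_mul (hb i j)) k,
    Finset.sum_congr rfl fun i _ => Finset.sum_congr rfl fun j _ =>
      pd_mul e (hh i j) (hb i j) k]
  -- With `h2`, the Christoffel terms in the derivative of `h` become those in the covariant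
  -- derivative of `b` after relabelling summation indices. Only the density term is left over, and
  -- it accounts for the weight `s - r`.
  have h1 : ∑ i, ∑ j, (∑ m, h i m z * Γ k m j z) * b i j z =
      ∑ i, ∑ j, h i j z * ∑ m, Γ k j m z * b i m z := by
    refine Finset.sum_congr rfl fun i _ => ?_
    exact (sum_mul_sum_comm _ _ _).symm
  have h2 : ∑ i, ∑ j, (∑ m, Γ k m i z * h m j z) * b i j z =
      ∑ i, ∑ j, h i j z * ∑ m, Γ k i m z * b m j z := by
    rw [Finset.sum_comm, Finset.sum_comm (f := fun i j => h i j z * ∑ m, Γ k i m z * b m j z)]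
    refine Finset.sum_congr rfl fun j _ => ?_
    rw [sum_mul_sum_comm]
    simp only [mul_comm (Γ k _ _ z)]
  have h3 : ∑ i, ∑ j, h i j z * covTwo e s Γ b k i j z =
      ∑ i, ∑ j, h i j z * pd e k (b i j) z - (∑ i, ∑ j, h i j z * ∑ m, Γ k i m z * b m j z
        + ∑ i, ∑ j, h i j z * ∑ m, Γ k j m z * b i m z)
        + s * traceSymbol Γ k z * ∑ i, ∑ j, h i j z * b i j z := by
    simp only [Finset.mul_sum (f := fun i => ∑ j, h i j z * b i j z),
      ← Finset.sum_add_distrib,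
      ← Finset.sum_sub_distrib]
    refine Finset.sum_congr rfl fun i _ => ?_
    rw [Finset.mul_sum, ← Finset.sum_add_distrib]
    refine Finset.sum_congr rfl fun j _ => ?_
    unfold covTwo
    ring
  have h4 : ∑ i, ∑ j, (pd e k (h i j) z * b i j z + h i j z * pd e k (b i j) z) =
      -(∑ i, ∑ j, (∑ m, h i m z * Γ k m j z) * b i j z)
        - (∑ i, ∑ j, (∑ m, Γ k m i z * h m j z) * b i j z)
        + r * traceSymbol Γ k z * (∑ i, ∑ j, h i j z * b i j z)
        + ∑ i, ∑ j, h i j z * pd e k (b i j) z := by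
    simp only [Finset.mul_sum (f := fun i => ∑ j, h i j z * b i j z),
      ← Finset.sum_add_distrib,
      ← Finset.sum_sub_distrib, ← Finset.sum_neg_distrib]
    refine Finset.sum_congr rfl fun i _ => ?_
    rw [Finset.mul_sum, ← Finset.sum_add_distrib, ← Finset.sum_add_distrib]
    refine Finset.sum_congr rfl fun j _ => ?_
    rw [hpar]
    ring
  rw [h3, h4, h1, h2]
  ring

/-- The curvature term of the Bochner formula. -/
lemma curvature_term {g h : Fin n → Fin n → ℝ} {R : Fin n → Fin n → Fin n → Fin n → ℝ}
    {F : Fin n → Fin n → ℝ} {X : Fin n → Fin n → Fin n → ℝ} {a : Fin n → ℝ} {r s : ℝ}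
    (hsymm : ∀ i j, h i j = h j i)
    (hinv : ∀ i j, ∑ m, g i m * h m j = if i = j then 1 else 0)
    (hinv' : ∀ i j, ∑ m, h i m * g m j = if i = j then 1 else 0)
    (hF : ∀ i j, F i j = -F j i)
    (hX : ∀ k j i, X k j i = -(∑ m, R k j i m * a m) + s * F k j * a i)
    (hR : ∀ k j i p, ∑ m, R k j i m * g m p + ∑ m, R k j p m * g i m = r * F k j * g i p) :
    ∑ j, ∑ l, h j l * ((∑ k, ∑ i, h k i * X k j i) * a l) =
      ∑ i, ∑ j, (∑ k, R k i j k) * ((∑ l, h l i * a l) * ∑ l, h l j * a l) := by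
  -- The components of `α^♯`; `ha` below lowers the index again.
  set v : Fin n → ℝ := fun i => ∑ l, h l i * a l with hv
  have hv' (j : Fin n) : ∑ l, h j l * a l = v j :=
    Finset.sum_congr rfl fun l _ => by rw [hsymm]
  have ha (m : Fin n) : a m = ∑ p, g m p * v p := by
    simp only [← hv']
    rw [sum_mul_sum_comm]
    simp [hinv]
  -- The weighted skew-symmetry `hR` exchanges the index `i` of `R` with the one contracted against
  -- `v`, at the cost of `-r F`. Contracting with `h` in `hk` then produces the Ricci trace.
  have hXe (k j i : Fin n) : X k j i = (s - r) * F k j * a i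
      + ∑ m, g i m * ∑ p, R k j p m * v p := by
    have h1 : ∑ m, R k j i m * a m = ∑ p, (∑ m, R k j i m * g m p) * v p := by
      rw [← sum_mul_sum_comm]
      simp only [← ha]
    have h2 : ∑ p, (∑ m, R k j i m * g m p) * v p =
        r * F k j * a i - ∑ p, (∑ m, R k j p m * g i m) * v p := by
      rw [ha i, Finset.mul_sum, ← Finset.sum_sub_distrib]
      refine Finset.sum_congr rfl fun p _ => ?_
      rw [eq_sub_of_add_eq (hR k j i p)]
      ring
    have h3 : ∑ p, (∑ m, R k j p m * g i m) * v p = ∑ m, g i m * ∑ p, R k j p m * v p := by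
      rw [sum_mul_sum_comm (fun m => g i m) v fun m p => R k j p m]
      simp only [mul_comm (g i _)]
    rw [hX, h1, h2, h3]
    ring
  have hk (k j : Fin n) : ∑ i, h k i * X k j i =
      (s - r) * F k j * v k + ∑ p, R k j p k * v p := by
    simp only [hXe, mul_add, Finset.sum_add_distrib]
    congr 1
    · rw [← hv', Finset.mul_sum]
      exact Finset.sum_congr rfl fun _ _ => by ring
    · rw [sum_mul_sum_comm]
      simp [hinv']
  -- A skew form evaluated on `(v, v)`: swapping the summation indices changes the sign of the sum.
  have hF0 : ∑ j, v j * ∑ k, (s - r) * F k j * v k = 0 := by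
    have h1 : ∑ j, v j * ∑ k, (s - r) * F k j * v k =
        -∑ j, v j * ∑ k, (s - r) * F k j * v k := by
      conv_lhs => simp only [Finset.mul_sum]; rw [Finset.sum_comm]
      simp only [Finset.mul_sum, ← Finset.sum_neg_distrib]
      refine Finset.sum_congr rfl fun j _ => Finset.sum_congr rfl fun k _ => ?_
      rw [hF]
      ring
    linarith
  calc ∑ j, ∑ l, h j l * ((∑ k, ∑ i, h k i * X k j i) * a l)
      = ∑ j, v j * ∑ k, ((s - r) * F k j * v k + ∑ p, R k j p k * v p) := by
        refine Finset.sum_congr rfl fun j _ => ?_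
        simp only [hk]
        rw [← hv', Finset.sum_mul]
        exact Finset.sum_congr rfl fun _ _ => by ring
    _ = ∑ j, v j * ∑ k, ∑ p, R k j p k * v p := by
        simp only [Finset.sum_add_distrib, mul_add, hF0, zero_add]
    _ = _ := by
        refine Finset.sum_congr rfl fun j _ => ?_
        rw [Finset.sum_comm, Finset.mul_sum]
        refine Finset.sum_congr rfl fun p _ => ?_
        rw [← Finset.sum_mul]
        ring

end LocalCalculus

/-! ### Christoffel symbols of the connection on the manifold -/

section Christoffel

variable {n : ℕ} {M : Type*} [TopologicalSpace M] [ChartedSpace (EuclideanSpace ℝ (Fin n)) M]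
  [IsManifold (𝓡 n) ∞ M]

/-- The Christoffel symbols of a connection in the preferred chart at `x`. -/
def christoffel (D : Connection n M) (x : M) (i j m : Fin n) (y : M) : ℝ :=
  (coordFrame x y).coord m (D (fun z => coordFrame x z j) y (coordFrame x y i))

lemma christoffel_sum (D : Connection n M) (x : M) (i j : Fin n) (y : M) :
    D (fun z => coordFrame x z j) y (coordFrame x y i) =
      ∑ m, christoffel D x i j m y • coordFrame x y m := by
  simp [christoffel]

/-- Smoothness of `D` is applied to global sections, so the coordinate field is first cut off by a
bump function equal to `1` near `x`. Locality of `D` removes the cutoff. -/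
lemma contMDiffAt_christoffel [T2Space M] {D : Connection n M}
    (hD : CovariantDerivative.ContMDiffCovariantDerivative D ∞) (x : M) (i j m : Fin n) :
    ContMDiffAt (𝓡 n) 𝓘(ℝ, ℝ) ∞ (christoffel D x i j m) x := by
  have hx : x ∈ (chartAt (EuclideanSpace ℝ (Fin n)) x).source := mem_chart_source _ x
  obtain ⟨ψ⟩ : Nonempty (SmoothBumpFunction (𝓡 n) x) := inferInstance
  have hσ := ContMDiffOn.smul_section_of_tsupport (n := ∞) (F := EuclideanSpace ℝ (Fin n))
    (V := (TangentSpace (𝓡 n) : M → Type _)) (ψ := ψ)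
    (ψ.contMDiff.contMDiffOn (s := (chartAt (EuclideanSpace ℝ (Fin n)) x).source))
    (chartAt (EuclideanSpace ℝ (Fin n)) x).open_source ψ.tsupport_subset_chartAt_source
    (contMDiffOn_coordFrame x j)
  have hDσ := (hD.contMDiff.contMDiff (σ := fun z => ψ z • coordFrame x z j)
    (by simpa using! hσ.contMDiffOn)).contMDiffAt (x := x) Filter.univ_mem
  have hv := ContMDiffAt.clm_bundle_apply hDσ (contMDiffAt_coordFrame hx i)
  refine (contMDiffAt_coordFrame_coord hx m hv).congr_of_eventuallyEq ?_
  -- Comparing the two derivatives at `y` requires the fields to agree on a neighbourhood of each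
  -- such `y`.
  have h1 : ∀ᶠ y in 𝓝 x, ∀ᶠ z in 𝓝 y, ψ z = 1 := eventually_eventually_nhds.mpr ψ.eventuallyEq_one
  filter_upwards [h1, (chartAt _ x).open_source.mem_nhds hx] with y hy hys
  have := connection_congr D (Z := fun z => coordFrame x z j)
    (Z' := fun z => ψ z • coordFrame x z j) (mdifferentiableAt_coordFrame hys j)
    (hy.mono fun z hz => by simp [hz])
  rw [christoffel, this]

/-- The torsion on two coordinate fields is the difference of their mutual derivatives, as their
bracket vanishes. -/
lemma christoffel_symm {D : Connection n M} (hD : D.torsion = 0) (x : M) (i j m : Fin n) :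
    christoffel D x i j m x = christoffel D x j i m x := by
  have hx : x ∈ (chartAt (EuclideanSpace ℝ (Fin n)) x).source := mem_chart_source _ x
  have h := D.torsion_apply (mdifferentiableAt_coordFrame hx i) (mdifferentiableAt_coordFrame hx j)
  rw [mlieBracket_coordFrame, hD, sub_zero] at h
  have h' := sub_eq_zero.mp h.symm
  rw [christoffel, h']
  rfl

/-- The components of the curvature in terms of the Christoffel symbols. -/
lemma curvature_coord {D : Connection n M}
    (hΓ : ∀ i j m, MDifferentiableAt (𝓡 n) 𝓘(ℝ, ℝ) (christoffel D x i j m) x)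
    (k i j m : Fin n) :
    (coordFrame x x).coord m (curvature D (fun y => coordFrame x y k) (fun y => coordFrame x y i)
        (fun y => coordFrame x y j) x) =
      mvfderiv (𝓡 n) (christoffel D x i j m) x (coordFrame x x k)
        - mvfderiv (𝓡 n) (christoffel D x k j m) x (coordFrame x x i)
        + ∑ l, (christoffel D x i j l x * christoffel D x k l m x
          - christoffel D x k j l x * christoffel D x i l m x) := by
  have hx : x ∈ (chartAt (EuclideanSpace ℝ (Fin n)) x).source := mem_chart_source _ x
  have h (k i : Fin n) : (coordFrame x x).coord m
      (D (fun y => D (fun z => coordFrame x z j) y (coordFrame x y i)) x (coordFrame x x k)) =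
      mvfderiv (𝓡 n) (christoffel D x i j m) x (coordFrame x x k)
        + ∑ l, christoffel D x i j l x * christoffel D x k l m x := by
    simp only [christoffel_sum]
    rw [connection_sum D _ (fun l => hΓ i j l) fun l => mdifferentiableAt_coordFrame hx l]
    simp only [map_sum, map_add, map_smul, Finset.sum_add_distrib, smul_eq_mul]
    rw [add_comm]
    congr 1
    simp [Finsupp.single_apply]
  unfold curvature
  rw [mlieBracket_coordFrame, map_zero, sub_zero, map_sub, h, h, Finset.sum_sub_distrib]
  ring

/-- The covariant derivative in terms of the Christoffel symbols. -/
def covComp (D : Connection n M) {p : ℕ} {w : ℝ} (T : WTensor n M p w) (x : M) (i : Fin n)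
    (J : Fin p → Fin n) (y : M) : ℝ :=
  mvfderiv (𝓡 n) (coordComp T x J) y (coordFrame x y i)
    - ∑ a, ∑ m, christoffel D x i (J a) m y * coordComp T x (Function.update J a m) y
    + w / n * (∑ m, christoffel D x i m m y) * coordComp T x J y

lemma leibDeriv_coordFrame (D : Connection n M) {p : ℕ} {w : ℝ} (T : WTensor n M p w) (x : M)
    (i : Fin n) (J : Fin p → Fin n) (y : M) :
    leibDeriv D T (coordFrame x) (fun a z => coordFrame x z (J a)) y (coordFrame x y i) =
      covComp D T x i J y := by
  unfold leibDeriv covComp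
  congr 2
  refine Finset.sum_congr rfl fun a _ => ?_
  rw [christoffel_sum, MultilinearMap.map_update_sum]
  refine Finset.sum_congr rfl fun m _ => ?_
  rw [MultilinearMap.map_update_smul, smul_eq_mul]
  congr 2
  funext b
  by_cases hb : b = a
  · subst hb; simp
  · simp [hb]

lemma coordComp_covDeriv_eq (D : Connection n M) {p : ℕ} {w : ℝ} {T : WTensor n M p w}
    (hT : T.IsSmooth) {x y : M} (h : y ∈ (chartAt (EuclideanSpace ℝ (Fin n)) x).source)
    (i : Fin n) (J : Fin p → Fin n) :
    coordComp (covDeriv D T) x (Fin.cons i J) y = covComp D T x i J y := by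
  rw [coordComp_covDeriv D hT h, ← leibDeriv_coordFrame]
  simp

/-- At the centre of the chart the formula is the definition of `covDeriv`, so `T` need not be
smooth. It is thus available for `Dα`, `dα` and `δα` in the second derivatives. -/
lemma coordComp_covDeriv_self (D : Connection n M) {p : ℕ} {w : ℝ} (T : WTensor n M p w) (x : M)
    (i : Fin n) (J : Fin p → Fin n) :
    coordComp (covDeriv D T) x (Fin.cons i J) x = covComp D T x i J x := by
  rw [← leibDeriv_coordFrame]
  have hJ : (fun a => coordFrame x x ((Fin.cons i J : Fin (p + 1) → Fin n) a)) =
      Fin.cons (coordFrame x x i) fun a => coordFrame x x (J a) := by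
    funext a
    refine Fin.cases ?_ (fun a => ?_) a <;> simp
  rw [coordComp, hJ, covDeriv_apply]
  rw [Finset.sum_eq_single i _ (by simp), Finset.sum_eq_single J _ (by simp)]
  · simp
    rfl
  · intro J' _ hJ'
    obtain ⟨a, ha⟩ := Function.ne_iff.mp hJ'
    rw [Finset.prod_eq_zero (Finset.mem_univ a) (by simp [Ne.symm ha])]
    simp
  · intro i' _ hi'
    simp [Finsupp.single_apply, Ne.symm hi']

end Christoffel

/-! ### Passage from functions on the manifold to their chart expressions -/

section Representations

variable {n : ℕ} {M : Type*} [TopologicalSpace M] [ChartedSpace (EuclideanSpace ℝ (Fin n)) M]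
  [IsManifold (𝓡 n) ∞ M]

/-- `F` is the expression of `f` in the preferred chart at `x`. -/
def ChartRepr (x : M) (f : M → ℝ) (F : EuclideanSpace ℝ (Fin n) → ℝ) : Prop :=
  ∀ y ∈ (chartAt (EuclideanSpace ℝ (Fin n)) x).source, f y = F (extChartAt (𝓡 n) x y)

lemma chartRepr_comp_symm (x : M) (f : M → ℝ) :
    ChartRepr (n := n) x f (f ∘ (extChartAt (𝓡 n) x).symm) := fun y hy => by
  rw [Function.comp_apply, (extChartAt (𝓡 n) x).left_inv (by simpa using hy)]

/-- The model has no boundary, so the target of the chart is a neighbourhood of each of its points.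
-/
lemma eventually_chart {x : M} {P : EuclideanSpace ℝ (Fin n) → Prop}
    (h : ∀ y ∈ (chartAt (EuclideanSpace ℝ (Fin n)) x).source, P (extChartAt (𝓡 n) x y)) {y : M}
    (hy : y ∈ (chartAt (EuclideanSpace ℝ (Fin n)) x).source) :
    ∀ᶠ z in 𝓝 (extChartAt (𝓡 n) x y), P z := by
  filter_upwards [extChartAt_target_mem_nhds' (I := 𝓡 n) ((extChartAt (𝓡 n) x).map_source
    (by simpa using hy : y ∈ (extChartAt (𝓡 n) x).source))] with z hz
  rw [← (extChartAt (𝓡 n) x).right_inv hz]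
  exact h _ (by simpa using (extChartAt (𝓡 n) x).map_target hz)

lemma ChartRepr.mvfderiv {x : M} {f : M → ℝ} {F : EuclideanSpace ℝ (Fin n) → ℝ}
    (h : ChartRepr x f F) {y : M} (hy : y ∈ (chartAt (EuclideanSpace ℝ (Fin n)) x).source)
    (hF : DifferentiableAt ℝ F (extChartAt (𝓡 n) x y)) (i : Fin n) :
    mvfderiv (𝓡 n) f y (coordFrame x y i) =
      pd (EuclideanSpace.basisFun (Fin n) ℝ) i F (extChartAt (𝓡 n) x y) := by
  have hf : MDifferentiableAt (𝓡 n) 𝓘(ℝ, ℝ) f y := by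
    have hφ : MDifferentiableAt (𝓡 n) 𝓘(ℝ, EuclideanSpace ℝ (Fin n)) (extChartAt (𝓡 n) x) y :=
      mdifferentiableAt_extChartAt hy
    refine (hF.mdifferentiableAt.comp y hφ).congr_of_eventuallyEq ?_
    filter_upwards [(chartAt _ x).open_source.mem_nhds hy] with z hz using h z hz
  rw [mvfderiv_coordFrame hy i hf, pd]
  congr 1
  refine Filter.EventuallyEq.fderiv_eq (eventually_chart (fun z hz => ?_) hy)
  rw [← h z hz, Function.comp_apply, (extChartAt (𝓡 n) x).left_inv (by simpa using hz)]

variable {D : Connection n M} {x : M}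
  {Γ : Fin n → Fin n → Fin n → EuclideanSpace ℝ (Fin n) → ℝ}

lemma covComp_zero_eq {w : ℝ} {T : WTensor n M 0 w} {a : EuclideanSpace ℝ (Fin n) → ℝ}
    (hΓ : ∀ i j m, ChartRepr x (christoffel D x i j m) (Γ i j m))
    (ha : ChartRepr x (coordComp T x ![]) a) {y : M}
    (hy : y ∈ (chartAt (EuclideanSpace ℝ (Fin n)) x).source)
    (hd : DifferentiableAt ℝ a (extChartAt (𝓡 n) x y)) (i : Fin n) :
    covComp D T x i ![] y =
      covZero (EuclideanSpace.basisFun (Fin n) ℝ) (w / n) Γ a i (extChartAt (𝓡 n) x y) := by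
  simp only [covComp, covZero, traceSymbol, ha.mvfderiv hy hd, ha y hy,
    fun m => hΓ i m m y hy, Finset.univ_eq_empty, Finset.sum_empty, sub_zero]

lemma covComp_one_eq {w : ℝ} {T : WTensor n M 1 w} {a : Fin n → EuclideanSpace ℝ (Fin n) → ℝ}
    (hΓ : ∀ i j m, ChartRepr x (christoffel D x i j m) (Γ i j m))
    (ha : ∀ j, ChartRepr x (coordComp T x ![j]) (a j)) {y : M}
    (hy : y ∈ (chartAt (EuclideanSpace ℝ (Fin n)) x).source)
    (hd : ∀ j, DifferentiableAt ℝ (a j) (extChartAt (𝓡 n) x y)) (i j : Fin n) :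
    covComp D T x i ![j] y =
      covOne (EuclideanSpace.basisFun (Fin n) ℝ) (w / n) Γ a i j (extChartAt (𝓡 n) x y) := by
  have h0 (m : Fin n) : Function.update ![j] 0 m = ![m] := by
    funext b; fin_cases b; rfl
  simp only [covComp, covOne, traceSymbol, (ha j).mvfderiv hy (hd j), Fin.sum_univ_one, h0,
    fun j => ha j y hy, Matrix.cons_val_zero, fun i j m => hΓ i j m y hy]

lemma covComp_two_eq {w : ℝ} {T : WTensor n M 2 w}
    {b : Fin n → Fin n → EuclideanSpace ℝ (Fin n) → ℝ}
    (hΓ : ∀ i j m, ChartRepr x (christoffel D x i j m) (Γ i j m))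
    (hb : ∀ i j, ChartRepr x (coordComp T x ![i, j]) (b i j)) {y : M}
    (hy : y ∈ (chartAt (EuclideanSpace ℝ (Fin n)) x).source)
    (hd : ∀ i j, DifferentiableAt ℝ (b i j) (extChartAt (𝓡 n) x y)) (k i j : Fin n) :
    covComp D T x k ![i, j] y =
      covTwo (EuclideanSpace.basisFun (Fin n) ℝ) (w / n) Γ b k i j (extChartAt (𝓡 n) x y) := by
  have h0 (m : Fin n) : Function.update ![i, j] 0 m = ![m, j] := by
    funext b; fin_cases b <;> rfl
  have h1 (m : Fin n) : Function.update ![i, j] 1 m = ![i, m] := by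
    funext b; fin_cases b <;> rfl
  simp only [covComp, covTwo, traceSymbol, (hb i j).mvfderiv hy (hd i j), Fin.sum_univ_two, h0, h1,
    fun i j => hb i j y hy, Matrix.cons_val_zero, Matrix.cons_val_one,
    fun i j m => hΓ i j m y hy]

end Representations

/-! ### Components of `d`, `δ`, the Laplacian, the inner product and the square of the Weyl–Dirac
operator -/

section Algebra

variable {n : ℕ} {M : Type*} [TopologicalSpace M] [ChartedSpace (EuclideanSpace ℝ (Fin n)) M]
  [IsManifold (𝓡 n) ∞ M]

lemma coordComp_weylExtDeriv_zero (D : Connection n M) {w : ℝ} (η : WForm n M 0 w) (x : M)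
    (j : Fin n) (y : M) :
    coordComp (weylExtDeriv D η).toTensor x ![j] y =
      coordComp (covDeriv D η.toTensor) x ![j] y := by
  change ((0).factorial : ℝ)⁻¹ * MultilinearMap.alternatization
    ((covDeriv D η.toTensor y).1 (coordFrame x y)) _ = _
  rw [MultilinearMap.alternatization_apply]
  simp [coordComp]

lemma coordComp_weylExtDeriv_one (D : Connection n M) {w : ℝ} (η : WForm n M 1 w) (x : M)
    (i j : Fin n) (y : M) :
    coordComp (weylExtDeriv D η).toTensor x ![i, j] y =
      coordComp (covDeriv D η.toTensor) x ![i, j] y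
        - coordComp (covDeriv D η.toTensor) x ![j, i] y := by
  have h (a : Fin 2) : ![j, i] a = ![i, j] (Equiv.swap 0 1 a) := by
    fin_cases a <;> rfl
  change ((1).factorial : ℝ)⁻¹ * MultilinearMap.alternatization
    ((covDeriv D η.toTensor y).1 (coordFrame x y)) _ = _
  rw [MultilinearMap.alternatization_apply]
  rw [show (Finset.univ : Finset (Equiv.Perm (Fin 2))) = {1, Equiv.swap 0 1} by decide,
    Finset.sum_pair (by decide)]
  simp [coordComp, h, MultilinearMap.domDomCongr_apply]
  ring

variable (c : ConformalStructure n M) (D : Connection n M)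

lemma coordComp_divergence {p : ℕ} {w : ℝ} (η : WForm n M (p + 1) w) (x : M)
    (J : Fin p → Fin n) (y : M) :
    coordComp (divergence c D η).toTensor x J y =
      -∑ k, ∑ l, (gram c.toFun y (coordFrame x y))⁻¹ k l *
        coordComp (covDeriv D η.toTensor) x (Fin.cons k (Fin.cons l J)) y := by
  have h (k l : Fin n) : (fun a => coordFrame x y
      ((Fin.cons k (Fin.cons l J) : Fin (p + 2) → Fin n) a)) =
      Fin.cons (coordFrame x y k) (Fin.cons (coordFrame x y l) fun a => coordFrame x y (J a)) := by
    funext a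
    refine Fin.cases rfl (fun a => Fin.cases rfl (fun a => rfl) a) a
  change -(∑ k, ∑ l, (gram c.toFun y (coordFrame x y))⁻¹ k l •
    curryTwo ((covDeriv D η.toTensor y).1 (coordFrame x y)) (coordFrame x y k)
      (coordFrame x y l) : Multi n y p) _ = _
  simp only [sum_apply, smul_apply, curryTwo_apply, smul_eq_mul, coordComp, h]

lemma coordComp_laplacian {p : ℕ} {w : ℝ} (T : WTensor n M p w) (x : M)
    (J : Fin p → Fin n) (y : M) :
    coordComp (laplacian c D T) x J y =
      -∑ k, ∑ l, (gram c.toFun y (coordFrame x y))⁻¹ k l *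
        coordComp (covDeriv D (covDeriv D T)) x (Fin.cons k (Fin.cons l J)) y := by
  have h (k l : Fin n) : (fun a => coordFrame x y
      ((Fin.cons k (Fin.cons l J) : Fin (p + 2) → Fin n) a)) =
      Fin.cons (coordFrame x y k) (Fin.cons (coordFrame x y l) fun a => coordFrame x y (J a)) := by
    funext a
    refine Fin.cases rfl (fun a => Fin.cases rfl (fun a => rfl) a) a
  change (-(∑ k, ∑ l, (gram c.toFun y (coordFrame x y))⁻¹ k l •
    curryTwo ((covDeriv D (covDeriv D T) y).1 (coordFrame x y)) (coordFrame x y k)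
      (coordFrame x y l) : Multi n y p)) _ = _
  simp only [neg_apply, sum_apply, smul_apply, curryTwo_apply, smul_eq_mul, coordComp, h]

lemma inner_apply {w₁ w₂ : ℝ} (β : WTensor n M 1 w₁) (γ : WTensor n M 1 w₂) (x y : M) :
    (c.inner β γ y).1 (coordFrame x y) =
      ∑ i, ∑ j, (gram c.toFun y (coordFrame x y))⁻¹ i j *
        (coordComp β x ![i] y * coordComp γ x ![j] y) := by
  have h (i : Fin n) : (fun a => coordFrame x y (![i] a)) = fun _ => coordFrame x y i := by
    funext a; fin_cases a; rfl
  simp only [coordComp, h]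
  rfl

lemma sharp_apply {w : ℝ} (γ : WTensor n M 1 w) (x y : M) :
    (c.sharp γ y).1 (coordFrame x y) =
      ∑ i, ∑ j, ((gram c.toFun y (coordFrame x y))⁻¹ i j * coordComp γ x ![i] y) •
        coordFrame x y j := by
  have h (i : Fin n) : (fun a => coordFrame x y (![i] a)) = fun _ => coordFrame x y i := by
    funext a; fin_cases a; rfl
  simp only [coordComp, h, mul_smul]
  rfl

lemma covDeriv_zero {p : ℕ} {w : ℝ} : covDeriv D (0 : WTensor n M p w) = 0 := by
  have h0 (x : M) (J : Fin p → Fin n) : coordComp (0 : WTensor n M p w) x J = fun _ => 0 := rfl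
  have h (x : M) (i : Fin n) (J : Fin p → Fin n) : derivComp D (0 : WTensor n M p w) x i J = 0 := by
    have h1 (a : Fin p) : ((0 : WTensor n M p w) x).1 (coordFrame x x)
        (Function.update (fun b => coordFrame x x (J b)) a (covCoord D x i (J a))) = 0 := rfl
    unfold derivComp
    rw [h0, Finset.sum_congr rfl fun a _ => h1 a]
    simp [mvfderiv]
  funext x
  refine Twisted.ext_frame (coordFrame x x) ?_
  change _ • _ = _
  simp only [h, zero_smul, Finset.sum_const_zero, smul_zero]
  rfl

lemma toTensor_zero {p : ℕ} {w : ℝ} : (0 : WForm n M p w).toTensor = 0 := rfl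

lemma weylExtDeriv_of_zero {p : ℕ} {w : ℝ} : weylExtDeriv D (0 : WForm n M p w) = 0 := by
  funext x
  refine Subtype.ext (funext fun f => ?_)
  change _ • MultilinearMap.alternatization ((covDeriv D (0 : WForm n M p w).toTensor x).1 f) = 0
  rw [toTensor_zero, covDeriv_zero]
  exact (congrArg _ (map_zero _)).trans (smul_zero _)

lemma divergence_of_zero {p : ℕ} {w : ℝ} : divergence c D (0 : WForm n M (p + 1) w) = 0 := by
  funext x
  refine Twisted.ext_frame (coordFrame x x) ?_
  ext v
  change -(∑ k, ∑ l, (gram c.toFun x (coordFrame x x))⁻¹ k l •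
    curryTwo ((covDeriv D (0 : WForm n M (p + 1) w).toTensor x).1 (coordFrame x x))
      (coordFrame x x k) (coordFrame x x l) : Multi n x p) v = 0
  rw [toTensor_zero, covDeriv_zero]
  simp

/-- Needed because weights such as `w + 2 - 2` and `w` agree only propositionally; the transport
changes no value. -/
lemma weylExtDeriv_cast {p : ℕ} {w₁ w₂ : ℝ} (h : w₁ = w₂) (η : WForm n M p w₁) (x : M) :
    (weylExtDeriv D (fun y => Twisted.cast h (η y)) x).1 = (weylExtDeriv D η x).1 := by
  subst h
  rfl

/-- Degree one is reached in two steps through degree zero (`dδ`) or degree two (`δd`, and `δδ` from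
degree three). The hypothesis removes the last contribution. -/
lemma weylDirac_weylDirac_one {Ω : MixedForm n M} (h3 : Ω 3 = 0) (w : ℝ) (x : M)
    (f : Frame n x) :
    (weylDirac c D (weylDirac c D Ω) 1 w x).1 f =
      (weylExtDeriv D (divergence c D (Ω 1 (w + 2))) x).1 f
        + (divergence c D (weylExtDeriv D (Ω 1 (w + 2))) x).1 f := by
  have h2 : weylDirac c D Ω 2 (w + 2) = weylExtDeriv D (Ω 1 (w + 2)) := by
    change weylExtDeriv D (Ω 1 (w + 2)) +
      (fun x => Twisted.cast _ (divergence c D (Ω 3 (w + 2 + 2)) x)) = _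
    rw [h3]
    funext y
    rw [Pi.zero_apply, divergence_of_zero]
    exact add_zero _
  change (weylExtDeriv D (fun y => Twisted.cast (by ring) (divergence c D (Ω 1 (w + 2)) y)) x).1 f
    + (divergence c D (weylDirac c D Ω 2 (w + 2)) x).1 f = _
  rw [weylExtDeriv_cast, h2]

end Algebra

/-! ### Assembly of the Bochner formula at a point -/

section Bochner

variable {n : ℕ} {M : Type*} [TopologicalSpace M] [ChartedSpace (EuclideanSpace ℝ (Fin n)) M]
  [IsManifold (𝓡 n) ∞ M]

lemma differentiableAt_finset_prod {E ι : Type*} [NormedAddCommGroup E] [NormedSpace ℝ E] {z : E}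
    {s : Finset ι} {f : ι → E → ℝ} (hf : ∀ i, DifferentiableAt ℝ (f i) z) :
    DifferentiableAt ℝ (fun y => ∏ i ∈ s, f i y) z :=
  open Classical in
  (HasFDerivAt.finsetProd fun i _ => (hf i).hasFDerivAt).differentiableAt

lemma differentiableAt_det {E : Type*} [NormedAddCommGroup E] [NormedSpace ℝ E] {m : ℕ} {z : E}
    {A : E → Matrix (Fin m) (Fin m) ℝ} (hA : ∀ i j, DifferentiableAt ℝ (fun y => A y i j) z) :
    DifferentiableAt ℝ (fun y => (A y).det) z := by
  simp only [Matrix.det_apply']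
  exact DifferentiableAt.fun_sum fun σ _ => (differentiableAt_const _).mul
    (differentiableAt_finset_prod fun i => hA _ _)

lemma differentiableAt_adjugate {E : Type*} [NormedAddCommGroup E] [NormedSpace ℝ E] {m : ℕ}
    {z : E} {A : E → Matrix (Fin m) (Fin m) ℝ}
    (hA : ∀ i j, DifferentiableAt ℝ (fun y => A y i j) z) (i j : Fin m) :
    DifferentiableAt ℝ (fun y => (A y).adjugate i j) z := by
  simp only [Matrix.adjugate_apply]
  refine differentiableAt_det fun k l => ?_
  by_cases hk : k = j
  · subst hk
    simp
  · simpa [hk] using hA k l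

/-- The normalisation gives determinant one, so the inverse is polynomial in the entries of the Gram
matrix; this is how its differentiability is obtained. -/
lemma ConformalStructure.inv_gram (c : ConformalStructure n M) (x : M) (f : Frame n x) :
    (gram c.toFun x f)⁻¹ = (gram c.toFun x f).adjugate := by
  rw [Matrix.inv_def, c.normalized]
  simp

lemma ConformalStructure.transpose_gram (c : ConformalStructure n M) (x : M) (f : Frame n x) :
    (gram c.toFun x f).transpose = gram c.toFun x f := by
  ext i j
  exact c.symm x f _ _

lemma ConformalStructure.inv_gram_symm (c : ConformalStructure n M) (x : M) (f : Frame n x)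
    (i j : Fin n) : (gram c.toFun x f)⁻¹ i j = (gram c.toFun x f)⁻¹ j i := by
  conv_lhs => rw [← c.transpose_gram, ← Matrix.transpose_nonsing_inv, Matrix.transpose_apply]

lemma gram_apply (c : ConformalStructure n M) (x y : M) (i j : Fin n) :
    gram c.toFun y (coordFrame x y) i j = coordComp c.toFun x ![i, j] y := by
  change (c.toFun y).1 _ _ = (c.toFun y).1 _ _
  congr 1
  funext a
  fin_cases a <;> rfl

lemma WTensor.IsSmooth.contDiffAt {p : ℕ} {w : ℝ} {T : WTensor n M p w} (hT : T.IsSmooth)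
    {x y : M} (hy : y ∈ (chartAt (EuclideanSpace ℝ (Fin n)) x).source) (J : Fin p → Fin n) :
    ContDiffAt ℝ ∞ (coordComp T x J ∘ (extChartAt (𝓡 n) x).symm) (extChartAt (𝓡 n) x y) :=
  contDiffAt_chart hy ((hT x J).contMDiffAt ((chartAt _ x).open_source.mem_nhds hy))

/-- The Bochner formula in terms of the components in the coordinate frame at `x`. -/
lemma bochner_components [T2Space M] (c : ConformalStructure n M) (D : WeylConnection c) {k : ℝ}
    (α : WForm n M 1 k) (hα : α.toTensor.IsSmooth) (x : M) :
    ∑ j, ∑ l, (gram c.toFun x (coordFrame x x))⁻¹ j l *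
      ((coordComp (weylExtDeriv D.conn (divergence c D.conn α)).toTensor x ![j] x
        + coordComp (divergence c D.conn (weylExtDeriv D.conn α)).toTensor x ![j] x)
          * coordComp α.toTensor x ![l] x) =
    ∑ j, ∑ l, (gram c.toFun x (coordFrame x x))⁻¹ j l *
      (coordComp (laplacian c D.conn α.toTensor) x ![j] x * coordComp α.toTensor x ![l] x)
    + ricci D.conn x ((c.sharp α.toTensor x).1 (coordFrame x x))
        ((c.sharp α.toTensor x).1 (coordFrame x x)) := by
  have hx : x ∈ (chartAt (EuclideanSpace ℝ (Fin n)) x).source := mem_chart_source _ x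
  set φ := extChartAt (𝓡 n) x with hφ
  set e : Fin n → EuclideanSpace ℝ (Fin n) := ⇑(EuclideanSpace.basisFun (Fin n) ℝ) with he
  have h2 : (2 : WithTop ℕ∞) ≤ ∞ := WithTop.coe_le_coe.2 (le_top : (2 : ℕ∞) ≤ ⊤)
  let a : Fin n → EuclideanSpace ℝ (Fin n) → ℝ := fun j => coordComp α.toTensor x ![j] ∘ φ.symm
  let Γ : Fin n → Fin n → Fin n → EuclideanSpace ℝ (Fin n) → ℝ :=
    fun i j m => christoffel D.conn x i j m ∘ φ.symm
  let g : Fin n → Fin n → EuclideanSpace ℝ (Fin n) → ℝ :=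
    fun i j => coordComp c.toFun x ![i, j] ∘ φ.symm
  let h : Fin n → Fin n → EuclideanSpace ℝ (Fin n) → ℝ :=
    fun i j => (fun y => (gram c.toFun y (coordFrame x y))⁻¹ i j) ∘ φ.symm
  have ra (j) : ChartRepr x (coordComp α.toTensor x ![j]) (a j) := chartRepr_comp_symm x _
  have rΓ (i j m) : ChartRepr x (christoffel D.conn x i j m) (Γ i j m) := chartRepr_comp_symm x _
  have rg (i j) : ChartRepr x (coordComp c.toFun x ![i, j]) (g i j) := chartRepr_comp_symm x _
  have rh (i j) : ChartRepr x (fun y => (gram c.toFun y (coordFrame x y))⁻¹ i j) (h i j) :=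
    chartRepr_comp_symm x _
  have ca {y : M} (hy) (j) : ContDiffAt ℝ 2 (a j) (φ y) := (hα.contDiffAt hy ![j]).of_le h2
  have da {y : M} (hy) (j) : DifferentiableAt ℝ (a j) (φ y) :=
    (ca hy j).differentiableAt (by norm_num)
  have cg {y : M} (hy) (i j) : ContDiffAt ℝ 2 (g i j) (φ y) :=
    (c.smooth.contDiffAt hy ![i, j]).of_le h2
  have dg {y : M} (hy) (i j) : DifferentiableAt ℝ (g i j) (φ y) :=
    (cg hy i j).differentiableAt (by norm_num)
  have cΓ (i j m) : ContDiffAt ℝ ∞ (Γ i j m) (φ x) :=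
    contDiffAt_chart hx (contMDiffAt_christoffel D.smooth x i j m)
  have dΓ (i j m) : DifferentiableAt ℝ (Γ i j m) (φ x) := (cΓ i j m).differentiableAt (by simp)
  have hgram (z) : gram c.toFun (φ.symm z) (coordFrame x (φ.symm z)) =
      Matrix.of fun i j => g i j z := by
    ext i j
    exact gram_apply c x _ i j
  have dh (i j) : DifferentiableAt ℝ (h i j) (φ x) := by
    have : h i j = fun z => (Matrix.of fun i j => g i j z).adjugate i j := by
      funext z
      simp only [h, Function.comp_apply, c.inv_gram, hgram]
    rw [this]
    exact differentiableAt_adjugate (fun i j => dg hx i j) i j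
  have hgh (z) (i j) : ∑ m, g i m z * h m j z = if i = j then 1 else 0 := by
    have := congrFun (congrFun (Matrix.mul_nonsing_inv (gram c.toFun (φ.symm z)
      (coordFrame x (φ.symm z))) (by rw [c.normalized]; exact isUnit_one)) i) j
    rw [Matrix.mul_apply, Matrix.one_apply] at this
    rw [← this]
    exact Finset.sum_congr rfl fun m _ => by rw [gram_apply]; rfl
  have hhg (z) (i j) : ∑ m, h i m z * g m j z = if i = j then 1 else 0 := by
    have := congrFun (congrFun (Matrix.nonsing_inv_mul (gram c.toFun (φ.symm z)
      (coordFrame x (φ.symm z))) (by rw [c.normalized]; exact isUnit_one)) i) j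
    rw [Matrix.mul_apply, Matrix.one_apply] at this
    rw [← this]
    exact Finset.sum_congr rfl fun m _ => by rw [gram_apply]; rfl
  have hsymm (z) (i j) : h i j z = h j i z := c.inv_gram_symm _ _ i j
  have hpar {y : M} (hy : y ∈ (chartAt (EuclideanSpace ℝ (Fin n)) x).source) (p i j) :
      covTwo e (2 / n) Γ g p i j (φ y) = 0 := by
    rw [← covComp_two_eq rΓ rg hy (dg hy) p i j, ← coordComp_covDeriv_eq D.conn c.smooth hy,
      D.parallel]
    rfl
  have hpar' : ∀ᶠ z in 𝓝 (φ x), ∀ p i j, covTwo e (2 / n) Γ g p i j z = 0 :=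
    eventually_chart (fun y hy => hpar hy) hx
  have hΓs (i j m) : Γ i j m (φ x) = Γ j i m (φ x) := by
    rw [← rΓ i j m x hx, ← rΓ j i m x hx, christoffel_symm D.torsion_eq_zero]
  set B := covOne e (k / n) Γ a with hB
  -- The first derivative has to be known on the whole chart domain, since it is differentiated
  -- again; this is where independence of the chart is used for `α`.
  have rB (i j) : ChartRepr x (coordComp (covDeriv D.conn α.toTensor) x ![i, j]) (B i j) := by
    intro y hy
    exact (coordComp_covDeriv_eq D.conn hα hy i ![j]).trans (covComp_one_eq rΓ ra hy (da hy) i j)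
  have dB (i j) : DifferentiableAt ℝ (B i j) (φ x) := differentiableAt_covOne e (ca hx) dΓ i j
  have hlap (p i j) : coordComp (covDeriv D.conn (covDeriv D.conn α.toTensor)) x
      (Fin.cons p (Fin.cons i ![j])) x = covTwo e (k / n) Γ B p i j (φ x) := by
    rw [coordComp_covDeriv_self]
    exact covComp_two_eq rΓ rB hx dB p i j
  have rd (i j) : ChartRepr x (coordComp (weylExtDeriv D.conn α).toTensor x ![i, j])
      (fun z => B i j z - B j i z) := by
    intro y hy
    rw [coordComp_weylExtDeriv_one, rB i j y hy, rB j i y hy]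
  have hδd (p i j) : coordComp (covDeriv D.conn (weylExtDeriv D.conn α).toTensor) x
      (Fin.cons p (Fin.cons i ![j])) x =
      covTwo e (k / n) Γ B p i j (φ x) - covTwo e (k / n) Γ B p j i (φ x) := by
    rw [coordComp_covDeriv_self]
    refine (covComp_two_eq rΓ rd hx (fun i j => (dB i j).sub (dB j i)) p i j).trans ?_
    change covTwo e (k / n) Γ (fun i j z => B i j z - B j i z) p i j (φ x) = _
    simp only [covTwo, pd_sub _ (dB i j) (dB j i), mul_sub, Finset.sum_sub_distrib]
    ring
  have rδ : ChartRepr x (coordComp (divergence c D.conn α).toTensor x ![])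
      (fun z => -∑ i, ∑ j, h i j z * B i j z) := by
    intro y hy
    rw [coordComp_divergence]
    refine congrArg _ (Finset.sum_congr rfl fun i _ => Finset.sum_congr rfl fun j _ => ?_)
    rw [← rh i j y hy, ← rB i j y hy]
    rfl
  have dS : DifferentiableAt ℝ (fun z => ∑ i, ∑ j, h i j z * B i j z) (φ x) :=
    DifferentiableAt.fun_sum fun i _ => DifferentiableAt.fun_sum fun j _ => (dh i j).mul (dB i j)
  have hdδ (p) : coordComp (weylExtDeriv D.conn (divergence c D.conn α)).toTensor x ![p] x =
      -∑ i, ∑ j, h i j (φ x) * covTwo e (k / n) Γ B p i j (φ x) := by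
    rw [coordComp_weylExtDeriv_zero]
    refine (coordComp_covDeriv_self D.conn (divergence c D.conn α).toTensor x p ![]).trans ?_
    -- The divergence has weight `k - 2`, and `(k - 2)/n = k/n - 2/n` is the weight `s - r` of the
    -- contraction.
    rw [covComp_zero_eq rΓ rδ hx dS.neg, ← covZero_contract e (r := 2 / n) dh dB p
      (fun i j => pd_inverse_metric e (dg hx) dh (Filter.Eventually.of_forall hgh) (hpar hx) p i j)]
    simp only [covZero, pd_neg, ← he, sub_div]
    ring
  have hh (i j) : (gram c.toFun x (coordFrame x x))⁻¹ i j = h i j (φ x) := rh i j x hx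
  have hX (p j i) := ricci_identity e (s := k / n) (ca hx) dΓ hΓs p j i
  have hR (p j i m) := curvSymbol_metric e (cg hx) dΓ hpar' p j i m
  have key := curvature_term (fun i j => hsymm (φ x) i j) (hgh (φ x)) (hhg (φ x))
    (fun i j => traceCurv_swap e i j) hX hR
  have hric (i j) : ricci D.conn x (coordFrame x x i) (coordFrame x x j) =
      ∑ p, curvSymbol e Γ p i j p (φ x) := by
    have hm (i j m) : MDifferentiableAt (𝓡 n) 𝓘(ℝ, ℝ) (christoffel D.conn x i j m) x :=
      (contMDiffAt_christoffel D.smooth x i j m).mdifferentiableAt (by simp)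
    simp only [ricci, Module.Basis.constr_basis, curvature_coord hm, curvSymbol,
      (rΓ _ _ _).mvfderiv hx (dΓ _ _ _), fun i j m => rΓ i j m x hx]
    rfl
  have hsharp : (c.sharp α.toTensor x).1 (coordFrame x x) =
      ∑ j, (∑ i, h i j (φ x) * a i (φ x)) • coordFrame x x j := by
    rw [sharp_apply, Finset.sum_comm]
    simp only [hh, fun i => ra i x hx, ← Finset.sum_smul]
    rfl
  have hric' : ricci D.conn x ((c.sharp α.toTensor x).1 (coordFrame x x))
        ((c.sharp α.toTensor x).1 (coordFrame x x)) =
      ∑ i, ∑ j, (∑ p, curvSymbol e Γ p i j p (φ x)) * ((∑ l, h l i (φ x) * a l (φ x)) *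
        ∑ l, h l j (φ x) * a l (φ x)) := by
    rw [hsharp]
    simp only [map_sum, map_smul, LinearMap.sum_apply, LinearMap.smul_apply, hric, smul_eq_mul]
    rw [Finset.sum_comm]
    refine Finset.sum_congr rfl fun i _ => ?_
    rw [Finset.mul_sum]
    refine Finset.sum_congr rfl fun j _ => ?_
    ring
  rw [hric', ← key, ← Finset.sum_add_distrib]
  refine Finset.sum_congr rfl fun j _ => ?_
  rw [← Finset.sum_add_distrib]
  refine Finset.sum_congr rfl fun l _ => ?_
  -- With the curvature side rewritten as the contracted commutator, the formula holds component by
  -- component before pairing with `α`.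
  rw [hdδ, coordComp_divergence, coordComp_laplacian, ra l x hx, hh, ← mul_add, ← add_mul]
  congr 2
  simp only [hh, hδd, hlap, mul_sub, Finset.sum_sub_distrib]
  rw [← hB]
  ring

/-- The components of `(𝒟^D)²` on a `1`-form. -/
lemma weylDirac_sq_of_eq (c : ConformalStructure n M) (D : Connection n M) {k w : ℝ}
    (h : w + 2 = k) (α : WForm n M 1 k) (x : M) (f : Frame n x) :
    (weylDirac c D (weylDirac c D α.toMixed) 1 w x).1 f =
      (weylExtDeriv D (divergence c D α) x).1 f + (divergence c D (weylExtDeriv D α) x).1 f := by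
  subst h
  have h1 : α.toMixed 1 (w + 2) = α := by simp [WForm.toMixed]
  have h3 : α.toMixed 3 = 0 := by simp [WForm.toMixed]
  rw [weylDirac_weylDirac_one c D h3, h1]

lemma weylDirac_sq_of_ne (c : ConformalStructure n M) (D : Connection n M) {k w : ℝ}
    (h : w + 2 ≠ k) (α : WForm n M 1 k) : weylDirac c D (weylDirac c D α.toMixed) 1 w = 0 := by
  have h1 : α.toMixed 1 (w + 2) = 0 := by simp [WForm.toMixed, h]
  have h3 : α.toMixed 3 = 0 := by simp [WForm.toMixed]
  funext x
  refine Twisted.ext_frame (coordFrame x x) ?_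
  rw [weylDirac_weylDirac_one c D h3, h1, divergence_of_zero, weylExtDeriv_of_zero,
    weylExtDeriv_of_zero, divergence_of_zero]
  exact add_zero _

end Bochner

end ConformalWeyl

end

theorem mainTheorem3 (n : ℕ) (M : Type*) [TopologicalSpace M] [T2Space M]
    [ChartedSpace (EuclideanSpace ℝ (Fin n)) M] [IsManifold (𝓡 n) ∞ M]
    (c : ConformalStructure n M) (D : WeylConnection c) (k : ℝ) (α : WForm n M 1 k)
    (hα : α.toTensor.IsSmooth) :
    c.innerMixed (weylDirac c D.conn (weylDirac c D.conn α.toMixed)) α =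
      Pi.single (2 * k - 4)
        (innerLaplacian c D.conn α.toTensor + ricciSharp c D.conn α.toTensor) := by
  funext w x
  refine Twisted.ext_frame (coordFrame x x) ?_
  refine (inner_apply c (weylDirac c D.conn (weylDirac c D.conn α.toMixed) 1
    (w - k + 2)).toTensor α.toTensor x x).trans ?_
  -- The component of weight `w` pairs `α` with the part of weight `w - k + 2`. The squared operator
  -- lowers the weight `k` by two in degree one, so this part can be nonzero only for `w = 2 k - 4`.
  by_cases hw : w = 2 * k - 4
  · subst hw
    have hsq (j : Fin n) : coordComp (weylDirac c D.conn (weylDirac c D.conn α.toMixed) 1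
        (2 * k - 4 - k + 2)).toTensor x ![j] x =
        coordComp (weylExtDeriv D.conn (divergence c D.conn α)).toTensor x ![j] x
          + coordComp (divergence c D.conn (weylExtDeriv D.conn α)).toTensor x ![j] x :=
      congrArg (fun η => η fun a => coordFrame x x (![j] a))
        (weylDirac_sq_of_eq c D.conn (w := 2 * k - 4 - k + 2) (by ring) α x (coordFrame x x))
    rw [Pi.single_eq_same]
    simp only [hsq]
    rw [bochner_components c D α hα x]
    exact congrArg (· + _) (inner_apply c (laplacian c D.conn α.toTensor) α.toTensor x x).symm
  · rw [Pi.single_eq_of_ne hw, weylDirac_sq_of_ne c D.conn (fun h => hw (by linarith)) α,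
      toTensor_zero]
    have h0 (i : Fin n) : coordComp (0 : WTensor n M 1 (w - k + 2)) x ![i] x = 0 := rfl
    simp only [h0, zero_mul, mul_zero, Finset.sum_const_zero]
    rfl
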